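/- **Conventions.** All $2$-categories, $2$-functors, $2$-natural transformations, $2$-adjunctions and $2$-monads are strict. Let $(F\dashv G,\varepsilon,\eta):\mathcal A\to\mathcal B$ be a $2$-adjunction, with $G:\mathcal A\to\mathcal B$ the right $2$-adjoint. *Lax idempotent, pre-Kock–Zöberlein.* A $2$-monad $(T,\mu,\eta)$ is lax idempotent if there is a modification $\Gamma:\mathrm{id}_{T^2}\Rightarrow \eta T\cdot\mu$ such that the whiskerings $\Gamma *\eta T$ and $\mu *\Gamma$ are identities (that is, $\mu\dashv\eta T$ with identity counit). A $2$-adjunction is lax idempotent if the $2$-monad it induces is lax idempotent. Its right $2$-adjoint is $2$-premonadic if the Eilenberg–Moore comparison $2$-functor into the $2$-category of strict algebras and strict morphisms is fully faithful, i.e. an isomorphism on hom-categories. It is pre-Kock–Zöberlein if the $2$-adjunction is lax idempotent and the right $2$-adjoint is $2$-premonadic. *Lax comma $2$-categories.* For an object $y$ of a $2$-category $\mathcal C$, the objects of $\mathcal C//y$ are the $1$-cells $a:w\to y$; a morphism from $a:w\to y$ to $b:x\to y$ is a pair $(f,\beta)$ with $f:w\to x$ and $\beta:b f\Rightarrow a$;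 a $2$-cell $(f,\beta)\Rightarrow(f',\beta')$ is a $2$-cell $\zeta:f\Rightarrow f'$ with $\beta'\cdot(b*\zeta)=\beta$. The comma $2$-category $\mathcal C/y$ is the locally full sub-$2$-category with the same objects and with the morphisms $(f,\beta)$ for which $\beta$ is an identity. *The relevant $2$-adjunctions.* Assume that, for every $y\in\mathcal B$ and every $1$-cell $b$ of $\mathcal B$ with codomain $GF(y)$, a comma object $$x\xleftarrow{\ \delta_b\ } b\downarrow\eta_y\xrightarrow{\ \eta_y^{\Leftarrow}(b)\ } y,\qquad \lambda^{b\downarrow\eta_y}: b\cdot\delta_b\Rightarrow\eta_y\cdot\eta_y^{\Leftarrow}(b)\qquad (b:x\to GF(y))$$ is chosen. Composition with $\eta_y$ and these comma objects give a $2$-adjunction $\eta_y!\dashv\eta_y^{\Leftarrow}:\mathcal B//GF(y)\to\mathcal B/y$. Write $\check F,\check G$ for the $2$-functors between lax comma $2$-categories given pointwise by $F,G$; the $2$-adjunction $F\dashv G$ lifts to $\varepsilon_{F(y)}!\circ\check F\dashv\check G:\mathcal A//F(y)\to\mathcal B//GF(y)$, where $\varepsilon_{F(y)}!$ is composition with $\varepsilon_{F(y)}$.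 *Simple, $2$-admissible.* $F\dashv G$ is simple if it is lax idempotent and, for every $y\in\mathcal B$, the composite $2$-adjunction $$\mathcal A//F(y)\longrightarrow\mathcal B//GF(y)\longrightarrow\mathcal B/y$$ of the two $2$-adjunctions above is lax idempotent. It is $2$-admissible if $G$ is pre-Kock–Zöberlein and, for every $y\in\mathcal B$, that composite $2$-adjunction is lax idempotent and its right $2$-adjoint $\eta_y^{\Leftarrow}\circ\check G$ is $2$-premonadic. *Regular epimorphism.* A $1$-cell $f:x\to y$ of a $2$-category is a regular epimorphism if it is the ($2$-dimensional) coequalizer of some pair $p,q:z\to x$: $fp=fq$; every $h:x\to w$ with $hp=hq$ is $kf$ for a unique $k:y\to w$; and, for $k,k':y\to w$, every $2$-cell $\xi:kf\Rightarrow k'f$ with $\xi*p=\xi*q$ is $\zeta*f$ for a unique $\zeta:k\Rightarrow k'$. **Corollary.** Assume that $G$ is pre-Kock–Zöberlein. Then $F\dashv G$ is $2$-admissible if and only if it is simple and, for every object $y\in\mathcal B$ and every object $a:w\to F(y)$ of $\mathcal A//F(y)$, the morphism $$\bigl(\varepsilon_w\cdot F(\delta_{G(a)}),\ \mathrm{id}_{\varepsilon_{F(y)}}*F(\lambda^{G(a)\downarrow\eta_y})\bigr):\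 F\bigl(\eta_y^{\Leftarrow}(G(a))\bigr)\longrightarrow a$$ of $\mathcal A//F(y)$ is a regular epimorphism in $\mathcal A//F(y)$. Here the domain is $F(\eta_y^{\Leftarrow}(G(a))):F(G(a)\downarrow\eta_y)\to F(y)$, and the $2$-cell goes from $a\cdot\varepsilon_w\cdot F(\delta_{G(a)})=\varepsilon_{F(y)}\cdot FG(a)\cdot F(\delta_{G(a)})$ to $\varepsilon_{F(y)}\cdot F(\eta_y)\cdot F(\eta_y^{\Leftarrow}(G(a)))=F(\eta_y^{\Leftarrow}(G(a)))$. -/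

import Mathlib

open CategoryTheory Bicategory

universe w₁ w₂ w₃ v₁ v₂ v₃ u₁ u₂ u₃

namespace TwoDim

/-! ### Equality of 2-cells in a 2-category

A 2-category is a `Bicategory` with `Bicategory.Strict`. Two 2-cells between the objects `a` and `b`
whose boundaries are only propositionally equal are compared as elements of the set of all
2-cells from `a` to `b`, that is, of the set of arrows of the hom-category `a ⟶ b`. -/

section Cells

variable {C : Type u₁} [Bicategory.{w₁, v₁} C]

/-- The 2-cells `θ` and `θ'` are equal (in particular, they have the same source 1-cell and the
same target 1-cell). -/
def CellEq {a b : C} {f g f' g' : a ⟶ b} (θ : f ⟶ g) (θ' : f' ⟶ g') : Prop :=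
  Arrow.mk θ = Arrow.mk θ'

infix:50 " ≗ " => CellEq

namespace CellEq

variable {a b c d : C}

theorem elim {f g f' g' : a ⟶ b} {θ : f ⟶ g} {θ' : f' ⟶ g'} (h : θ ≗ θ')
    {P : ∀ {f' g' : a ⟶ b}, (f' ⟶ g') → Prop} (h₀ : P θ) : P θ' := by
  have key : ∀ x : Arrow (a ⟶ b), Arrow.mk θ = x → P x.hom := by
    rintro x rfl; exact h₀
  exact key _ h

theorem rfl {f g : a ⟶ b} {θ : f ⟶ g} : θ ≗ θ := Eq.refl _

theorem symm {f g f' g' : a ⟶ b} {θ : f ⟶ g} {θ' : f' ⟶ g'} (h : θ ≗ θ') : θ' ≗ θ :=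
  Eq.symm h

theorem trans {f g f' g' f'' g'' : a ⟶ b} {θ : f ⟶ g} {θ' : f' ⟶ g'} {θ'' : f'' ⟶ g''}
    (h : θ ≗ θ') (h' : θ' ≗ θ'') : θ ≗ θ'' :=
  Eq.trans h h'

theorem of_eq {f g : a ⟶ b} {θ θ' : f ⟶ g} (h : θ = θ') : θ ≗ θ' := by subst h; exact rfl

theorem eq {f g : a ⟶ b} {θ θ' : f ⟶ g} (h : θ ≗ θ') : θ = θ' := by
  simpa using (Arrow.mk_inj _ _).1 h

theorem src {f g f' g' : a ⟶ b} {θ : f ⟶ g} {θ' : f' ⟶ g'} (h : θ ≗ θ') : f = f' :=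
  congrArg (fun x : Arrow (a ⟶ b) => x.left) h

theorem tgt {f g f' g' : a ⟶ b} {θ : f ⟶ g} {θ' : f' ⟶ g'} (h : θ ≗ θ') : g = g' :=
  congrArg (fun x : Arrow (a ⟶ b) => x.right) h

theorem comp {f g k f' g' k' : a ⟶ b} {θ : f ⟶ g} {φ : g ⟶ k} {θ' : f' ⟶ g'} {φ' : g' ⟶ k'}
    (h : θ ≗ θ') (h' : φ ≗ φ') : θ ≫ φ ≗ θ' ≫ φ' := by
  obtain rfl := h.src
  obtain rfl := h.tgt
  obtain rfl := h'.tgt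
  rw [h.eq, h'.eq]; exact rfl

theorem whiskerLeft {p p' : a ⟶ b} (hp : p = p') {f g f' g' : b ⟶ c} {θ : f ⟶ g}
    {θ' : f' ⟶ g'} (h : θ ≗ θ') : p ◁ θ ≗ p' ◁ θ' := by
  obtain rfl := h.src
  obtain rfl := h.tgt
  subst hp
  rw [h.eq]; exact rfl

theorem whiskerRight {f g f' g' : a ⟶ b} {θ : f ⟶ g} {θ' : f' ⟶ g'} (h : θ ≗ θ')
    {p p' : b ⟶ c} (hp : p = p') : θ ▷ p ≗ θ' ▷ p' := by
  obtain rfl := h.src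
  obtain rfl := h.tgt
  subst hp
  rw [h.eq]; exact rfl

theorem eqToHom {f g : a ⟶ b} (h : f = g) : eqToHom h ≗ 𝟙 f := by subst h; exact rfl

theorem id {f g : a ⟶ b} (h : f = g) : 𝟙 f ≗ 𝟙 g := by subst h; exact rfl

theorem id_comp {f f' g' g : a ⟶ b} {θ : f ⟶ f'} {φ : f' ⟶ g} (h : θ ≗ 𝟙 g') : θ ≫ φ ≗ φ := by
  obtain rfl := h.src
  obtain rfl := h.tgt
  rw [h.eq, Category.id_comp]; exact rfl

theorem comp_id {f f' g' g : a ⟶ b} {θ : f ⟶ f'} {φ : f' ⟶ g} (h : φ ≗ 𝟙 g') : θ ≫ φ ≗ θ := by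
  obtain rfl := h.src
  obtain rfl := h.tgt
  rw [h.eq, Category.comp_id]; exact rfl

theorem eqToHom_comp {f f' g : a ⟶ b} (h : f = f') (θ : f' ⟶ g) :
    CategoryTheory.eqToHom h ≫ θ ≗ θ := id_comp (eqToHom h)

theorem comp_eqToHom {f g g' : a ⟶ b} (θ : f ⟶ g) (h : g = g') :
    θ ≫ CategoryTheory.eqToHom h ≗ θ := comp_id (eqToHom h)

theorem whiskerLeft_id (p : a ⟶ b) {f f' f'' : b ⟶ c} {θ : f ⟶ f'} (h : θ ≗ 𝟙 f'') :
    p ◁ θ ≗ 𝟙 (p ≫ f'') :=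
  (whiskerLeft (Eq.refl p) h).trans (of_eq (Bicategory.whiskerLeft_id _ _))

theorem id_whiskerRight {f f' f'' : a ⟶ b} {θ : f ⟶ f'} (h : θ ≗ 𝟙 f'') (p : b ⟶ c) :
    θ ▷ p ≗ 𝟙 (f'' ≫ p) :=
  (whiskerRight h (Eq.refl p)).trans (of_eq (Bicategory.id_whiskerRight _ _))

theorem isId_congr {f g k k' : a ⟶ b} {θ : f ⟶ g} (h : θ ≗ 𝟙 k) (hk : k = k') : θ ≗ 𝟙 k' :=
  h.trans (id hk)

theorem iff_eqToHom {f g f' g' : a ⟶ b} {θ : f ⟶ g} {θ' : f' ⟶ g'} (hf : f = f') (hg : g = g') :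
    θ ≗ θ' ↔ θ = CategoryTheory.eqToHom hf ≫ θ' ≫ CategoryTheory.eqToHom hg.symm := by
  subst hf hg
  simp only [eqToHom_refl, Category.id_comp, Category.comp_id]
  exact ⟨eq, of_eq⟩

section Strict

variable [Strict C]

theorem assoc_hom (f : a ⟶ b) (g : b ⟶ c) (h : c ⟶ d) : (α_ f g h).hom ≗ 𝟙 ((f ≫ g) ≫ h) := by
  rw [Strict.associator_eqToIso, eqToIso.hom]; exact eqToHom _

theorem assoc_inv (f : a ⟶ b) (g : b ⟶ c) (h : c ⟶ d) : (α_ f g h).inv ≗ 𝟙 (f ≫ g ≫ h) := by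
  rw [Strict.associator_eqToIso, eqToIso.inv]; exact eqToHom _

theorem left_hom (f : a ⟶ b) : (λ_ f).hom ≗ 𝟙 f := by
  rw [Strict.leftUnitor_eqToIso, eqToIso.hom]; exact (eqToHom _).trans (id (Strict.id_comp _))

theorem left_inv (f : a ⟶ b) : (λ_ f).inv ≗ 𝟙 f := by
  rw [Strict.leftUnitor_eqToIso, eqToIso.inv]; exact eqToHom _

theorem right_hom (f : a ⟶ b) : (ρ_ f).hom ≗ 𝟙 f := by
  rw [Strict.rightUnitor_eqToIso, eqToIso.hom]; exact (eqToHom _).trans (id (Strict.comp_id _))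

theorem right_inv (f : a ⟶ b) : (ρ_ f).inv ≗ 𝟙 f := by
  rw [Strict.rightUnitor_eqToIso, eqToIso.inv]; exact eqToHom _

theorem id_whiskerLeft {f g : a ⟶ b} (θ : f ⟶ g) : 𝟙 a ◁ θ ≗ θ := by
  rw [Bicategory.id_whiskerLeft]
  exact (id_comp (left_hom _)).trans (comp_id (left_inv _))

theorem whiskerRight_id {f g : a ⟶ b} (θ : f ⟶ g) : θ ▷ 𝟙 b ≗ θ := by
  rw [Bicategory.whiskerRight_id]
  exact (id_comp (right_hom _)).trans (comp_id (right_inv _))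

theorem comp_whiskerLeft (p : a ⟶ b) (q : b ⟶ c) {f g : c ⟶ d} (θ : f ⟶ g) :
    (p ≫ q) ◁ θ ≗ p ◁ q ◁ θ := by
  rw [Bicategory.comp_whiskerLeft]
  exact (id_comp (assoc_hom _ _ _)).trans (comp_id (assoc_inv _ _ _))

theorem whiskerRight_comp {f g : a ⟶ b} (θ : f ⟶ g) (p : b ⟶ c) (q : c ⟶ d) :
    θ ▷ (p ≫ q) ≗ θ ▷ p ▷ q := by
  rw [Bicategory.whiskerRight_comp]
  exact (id_comp (assoc_inv _ _ _)).trans (comp_id (assoc_hom _ _ _))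

theorem whisker_assoc (p : a ⟶ b) {f g : b ⟶ c} (θ : f ⟶ g) (q : c ⟶ d) :
    (p ◁ θ) ▷ q ≗ p ◁ θ ▷ q := by
  rw [Bicategory.whisker_assoc]
  exact (id_comp (assoc_hom _ _ _)).trans (comp_id (assoc_inv _ _ _))

end Strict

end CellEq

end Cells

/-! ### 2-functors, 2-adjunctions, 2-monads

2-functors are `StrictPseudofunctor`s. -/

section Functors

variable {A : Type u₁} [Bicategory.{w₁, v₁} A] {B : Type u₂} [Bicategory.{w₂, v₂} B]
  {C : Type u₃} [Bicategory.{w₃, v₃} C]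

theorem CellEq.map (F : StrictPseudofunctor A B) {a b : A} {f g f' g' : a ⟶ b} {θ : f ⟶ g}
    {θ' : f' ⟶ g'} (h : θ ≗ θ') : F.map₂ θ ≗ F.map₂ θ' := by
  obtain rfl := h.src
  obtain rfl := h.tgt
  rw [h.eq]; exact CellEq.rfl

theorem map₂_whiskerLeft (F : StrictPseudofunctor A B) {a b c : A} (p : a ⟶ b) {f g : b ⟶ c}
    (θ : f ⟶ g) : F.map₂ (p ◁ θ) ≗ F.map p ◁ F.map₂ θ := by
  rw [F.map₂_whisker_left, F.mapComp_eq_eqToIso, F.mapComp_eq_eqToIso, eqToIso.hom, eqToIso.inv]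
  exact (CellEq.eqToHom_comp _ _).trans (CellEq.comp_eqToHom _ _)

theorem map₂_whiskerRight (F : StrictPseudofunctor A B) {a b c : A} {f g : a ⟶ b}
    (θ : f ⟶ g) (p : b ⟶ c) : F.map₂ (θ ▷ p) ≗ F.map₂ θ ▷ F.map p := by
  rw [F.map₂_whisker_right, F.mapComp_eq_eqToIso, F.mapComp_eq_eqToIso, eqToIso.hom, eqToIso.inv]
  exact (CellEq.eqToHom_comp _ _).trans (CellEq.comp_eqToHom _ _)

theorem map₂_isId (F : StrictPseudofunctor A B) {a b : A} {f g k : a ⟶ b}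
    {θ : f ⟶ g} (h : θ ≗ 𝟙 k) : F.map₂ θ ≗ 𝟙 (F.map k) := by
  have := h.map F
  rwa [F.map₂_id] at this

/-- Construct a 2-functor, with the compatibility with whiskering given as equality of 2-cells. -/
def mkTwoFunctor [Strict A] [Strict B] (P : PrelaxFunctor A B)
    (map_id : ∀ a : A, P.map (𝟙 a) = 𝟙 (P.obj a))
    (map_comp : ∀ {a b c : A} (f : a ⟶ b) (g : b ⟶ c), P.map (f ≫ g) = P.map f ≫ P.map g)
    (whiskerLeft : ∀ {a b c : A} (f : a ⟶ b) {g g' : b ⟶ c} (θ : g ⟶ g'),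
      P.map₂ (f ◁ θ) ≗ P.map f ◁ P.map₂ θ)
    (whiskerRight : ∀ {a b c : A} {f f' : a ⟶ b} (θ : f ⟶ f') (g : b ⟶ c),
      P.map₂ (θ ▷ g) ≗ P.map₂ θ ▷ P.map g) : StrictPseudofunctor A B :=
  StrictPseudofunctor.mk''
    { P with
      map_id := map_id
      map_comp := map_comp
      map₂_whisker_left := fun f _ _ θ => (CellEq.iff_eqToHom (map_comp _ _) (map_comp _ _)).1 (whiskerLeft f θ)
      map₂_whisker_right := fun θ g => (CellEq.iff_eqToHom (map_comp _ _) (map_comp _ _)).1 (whiskerRight θ g) }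

/-- A 2-functor is fully faithful if it is locally an isomorphism of categories. -/
def IsFullyFaithful (F : StrictPseudofunctor A B) : Prop :=
  ∀ a b : A, Function.Bijective (fun f : a ⟶ b => F.map f) ∧
    ∀ f g : a ⟶ b, Function.Bijective (fun θ : f ⟶ g => F.map₂ θ)

variable (A B) in
/-- A 2-adjunction `(F ⊣ G, ε, η) : A ⟶ B` between 2-categories, with `G : A ⟶ B` the right
2-adjoint: the counit `ε : FG ⟶ 1` and the unit `η : 1 ⟶ GF` are 2-natural transformations, that
is, natural with respect to 1-cells and 2-cells, and satisfy the triangle identities. -/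
structure TwoAdjunction where
  /-- the left 2-adjoint -/
  F : StrictPseudofunctor B A
  /-- the right 2-adjoint -/
  G : StrictPseudofunctor A B
  /-- the components of the counit `ε` -/
  counit (a : A) : F.obj (G.obj a) ⟶ a
  counit_naturality {a b : A} (f : a ⟶ b) : F.map (G.map f) ≫ counit b = counit a ≫ f
  counit_naturality₂ {a b : A} {f g : a ⟶ b} (θ : f ⟶ g) :
    F.map₂ (G.map₂ θ) ▷ counit b ≗ counit a ◁ θ
  /-- the components of the unit `η` -/
  unit (b : B) : b ⟶ G.obj (F.obj b)
  unit_naturality {a b : B} (f : a ⟶ b) : f ≫ unit b = unit a ≫ G.map (F.map f)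
  unit_naturality₂ {a b : B} {f g : a ⟶ b} (θ : f ⟶ g) :
    θ ▷ unit b ≗ unit a ◁ G.map₂ (F.map₂ θ)
  triangle_F (b : B) : F.map (unit b) ≫ counit (F.obj b) = 𝟙 (F.obj b)
  triangle_G (a : A) : unit (G.obj a) ≫ G.map (counit a) = 𝟙 (G.obj a)

variable (B) in
/-- A 2-monad `(T, μ, η)` on a 2-category. -/
structure TwoMonad where
  /-- the underlying endo-2-functor -/
  T : StrictPseudofunctor B B
  /-- the components of the multiplication, which is a 2-natural transformation `μ : TT ⟶ T` -/
  mul (b : B) : T.obj (T.obj b) ⟶ T.obj b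
  mul_naturality {a b : B} (f : a ⟶ b) : T.map (T.map f) ≫ mul b = mul a ≫ T.map f
  mul_naturality₂ {a b : B} {f g : a ⟶ b} (θ : f ⟶ g) :
    T.map₂ (T.map₂ θ) ▷ mul b ≗ mul a ◁ T.map₂ θ
  /-- the components of the unit, which is a 2-natural transformation `η : 1 ⟶ T` -/
  unit (b : B) : b ⟶ T.obj b
  unit_naturality {a b : B} (f : a ⟶ b) : f ≫ unit b = unit a ≫ T.map f
  unit_naturality₂ {a b : B} {f g : a ⟶ b} (θ : f ⟶ g) : θ ▷ unit b ≗ unit a ◁ T.map₂ θ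
  assoc (b : B) : T.map (mul b) ≫ mul b = mul (T.obj b) ≫ mul b
  left_unit (b : B) : unit (T.obj b) ≫ mul b = 𝟙 (T.obj b)
  right_unit (b : B) : T.map (unit b) ≫ mul b = 𝟙 (T.obj b)

namespace TwoAdjunction

/-- The 2-monad `(GF, GεF, η)` induced by a 2-adjunction. -/
def monad (adj : TwoAdjunction A B) : TwoMonad B where
  T := adj.F.comp adj.G
  mul b := adj.G.map (adj.counit (adj.F.obj b))
  mul_naturality {a b} f := by
    have h : adj.G.map (adj.F.map (adj.G.map (adj.F.map f))) ≫
        adj.G.map (adj.counit (adj.F.obj b)) =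
        adj.G.map (adj.counit (adj.F.obj a)) ≫ adj.G.map (adj.F.map f) := by
      rw [← adj.G.map_comp, ← adj.G.map_comp, adj.counit_naturality]
    exact h
  mul_naturality₂ θ :=
    ((map₂_whiskerRight adj.G _ _).symm.trans
      ((adj.counit_naturality₂ (adj.F.map₂ θ)).map adj.G)).trans (map₂_whiskerLeft _ _ _)
  unit := adj.unit
  unit_naturality := adj.unit_naturality
  unit_naturality₂ := adj.unit_naturality₂
  assoc b := by
    have h : adj.G.map (adj.F.map (adj.G.map (adj.counit (adj.F.obj b)))) ≫
        adj.G.map (adj.counit (adj.F.obj b)) =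
        adj.G.map (adj.counit (adj.F.obj (adj.G.obj (adj.F.obj b)))) ≫
          adj.G.map (adj.counit (adj.F.obj b)) := by
      rw [← adj.G.map_comp, ← adj.G.map_comp, adj.counit_naturality]
    exact h
  left_unit b := adj.triangle_G (adj.F.obj b)
  right_unit b := by
    have h : adj.G.map (adj.F.map (adj.unit b)) ≫ adj.G.map (adj.counit (adj.F.obj b)) =
        𝟙 (adj.G.obj (adj.F.obj b)) := by
      rw [← adj.G.map_comp, adj.triangle_F, adj.G.map_id]
    exact h

variable [Strict A] [Strict B] [Strict C]

/-- The composite 2-adjunction `FH ⊣ JG : A ⟶ C` of `(F ⊣ G, ε, η) : A ⟶ B` and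
`(H ⊣ J, δ, ρ) : B ⟶ C`, with counit `ε · FδG` and unit `JηH · ρ`. -/
def comp (adj : TwoAdjunction A B) (adj' : TwoAdjunction B C) : TwoAdjunction A C where
  F := adj'.F.comp adj.F
  G := adj.G.comp adj'.G
  counit a := adj.F.map (adj'.counit (adj.G.obj a)) ≫ adj.counit a
  counit_naturality {a b} f := by
    have h : adj.F.map (adj'.F.map (adj'.G.map (adj.G.map f))) ≫
        adj.F.map (adj'.counit (adj.G.obj b)) ≫ adj.counit b =
        (adj.F.map (adj'.counit (adj.G.obj a)) ≫ adj.counit a) ≫ f := by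
      rw [Category.assoc, ← adj.counit_naturality, ← Category.assoc, ← adj.F.map_comp,
        adj'.counit_naturality, adj.F.map_comp, Category.assoc]
    exact h
  counit_naturality₂ {a b f g} θ := by
    have h : adj.F.map₂ (adj'.F.map₂ (adj'.G.map₂ (adj.G.map₂ θ))) ▷
        (adj.F.map (adj'.counit (adj.G.obj b)) ≫ adj.counit b) ≗
        (adj.F.map (adj'.counit (adj.G.obj a)) ≫ adj.counit a) ◁ θ := by
      refine (CellEq.whiskerRight_comp _ _ _).trans
        (CellEq.trans ?_ (CellEq.comp_whiskerLeft _ _ _).symm)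
      refine CellEq.trans ?_ (CellEq.whiskerLeft rfl (adj.counit_naturality₂ θ))
      refine CellEq.trans ?_ (CellEq.whisker_assoc _ _ _)
      refine CellEq.whiskerRight ?_ rfl
      exact ((map₂_whiskerRight _ _ _).symm.trans
        ((adj'.counit_naturality₂ _).map adj.F)).trans (map₂_whiskerLeft _ _ _)
    exact h
  unit c := adj'.unit c ≫ adj'.G.map (adj.unit (adj'.F.obj c))
  unit_naturality {a b} f := by
    have h : f ≫ adj'.unit b ≫ adj'.G.map (adj.unit (adj'.F.obj b)) =
        (adj'.unit a ≫ adj'.G.map (adj.unit (adj'.F.obj a))) ≫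
          adj'.G.map (adj.G.map (adj.F.map (adj'.F.map f))) := by
      rw [Category.assoc, ← adj'.G.map_comp, ← adj.unit_naturality, adj'.G.map_comp,
        ← Category.assoc, adj'.unit_naturality, Category.assoc]
    exact h
  unit_naturality₂ {a b f g} θ := by
    have h : θ ▷ (adj'.unit b ≫ adj'.G.map (adj.unit (adj'.F.obj b))) ≗
        (adj'.unit a ≫ adj'.G.map (adj.unit (adj'.F.obj a))) ◁
          adj'.G.map₂ (adj.G.map₂ (adj.F.map₂ (adj'.F.map₂ θ))) := by
      refine (CellEq.whiskerRight_comp _ _ _).trans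
        (CellEq.trans ?_ (CellEq.comp_whiskerLeft _ _ _).symm)
      refine (CellEq.whiskerRight (adj'.unit_naturality₂ θ) rfl).trans ?_
      refine (CellEq.whisker_assoc _ _ _).trans ?_
      refine CellEq.whiskerLeft rfl ?_
      exact ((map₂_whiskerRight _ _ _).symm.trans
        ((adj.unit_naturality₂ _).map adj'.G)).trans (map₂_whiskerLeft _ _ _)
    exact h
  triangle_F c := by
    have h : adj.F.map (adj'.F.map (adj'.unit c ≫ adj'.G.map (adj.unit (adj'.F.obj c)))) ≫
        adj.F.map (adj'.counit (adj.G.obj (adj.F.obj (adj'.F.obj c)))) ≫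
          adj.counit (adj.F.obj (adj'.F.obj c)) = 𝟙 (adj.F.obj (adj'.F.obj c)) := by
      rw [adj'.F.map_comp, ← Category.assoc, ← adj.F.map_comp, Category.assoc,
        adj'.counit_naturality, ← Category.assoc (adj'.F.map _), adj'.triangle_F,
        Category.id_comp, adj.triangle_F]
    exact h
  triangle_G a := by
    have h : (adj'.unit (adj'.G.obj (adj.G.obj a)) ≫
        adj'.G.map (adj.unit (adj'.F.obj (adj'.G.obj (adj.G.obj a))))) ≫
        adj'.G.map (adj.G.map (adj.F.map (adj'.counit (adj.G.obj a)) ≫ adj.counit a)) =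
        𝟙 (adj'.G.obj (adj.G.obj a)) := by
      rw [adj.G.map_comp, Category.assoc, ← adj'.G.map_comp, ← Category.assoc (adj.unit _),
        ← adj.unit_naturality, Category.assoc, adj.triangle_G, Category.comp_id, adj'.triangle_G]
    exact h

end TwoAdjunction

end Functors


/-! ### The 2-category of strict algebras of a 2-monad and the comparison 2-functor -/

section Algebras

variable {B : Type u₂} [Bicategory.{w₂, v₂} B]

/-- A strict algebra of the 2-monad `M`. -/
structure TwoMonad.Alg (M : TwoMonad B) where
  /-- the underlying object -/
  obj : B
  /-- the structure 1-cell -/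
  str : M.T.obj obj ⟶ obj
  unit : M.unit obj ≫ str = 𝟙 obj
  assoc : M.mul obj ≫ str = M.T.map str ≫ str

namespace TwoMonad.Alg

variable {M : TwoMonad B}

/-- A strict morphism of algebras. -/
@[ext]
structure Hom (X Y : M.Alg) where
  /-- the underlying 1-cell -/
  mor : X.obj ⟶ Y.obj
  w : M.T.map mor ≫ Y.str = X.str ≫ mor

/-- A 2-cell between strict morphisms of algebras. -/
@[ext]
structure Hom₂ {X Y : M.Alg} (f g : Hom X Y) where
  /-- the underlying 2-cell -/
  cell : f.mor ⟶ g.mor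
  w : M.T.map₂ cell ▷ Y.str ≗ X.str ◁ cell

instance (X Y : M.Alg) : Category (Hom X Y) where
  Hom f g := Hom₂ f g
  id f := ⟨𝟙 f.mor, by
    rw [M.T.map₂_id, id_whiskerRight, whiskerLeft_id]; exact CellEq.id f.w⟩
  comp θ φ := ⟨θ.cell ≫ φ.cell, by
    rw [M.T.map₂_comp, comp_whiskerRight, whiskerLeft_comp]; exact θ.w.comp φ.w⟩
  id_comp θ := Hom₂.ext (Category.id_comp θ.cell)
  comp_id θ := Hom₂.ext (Category.comp_id θ.cell)
  assoc θ φ ψ := Hom₂.ext (Category.assoc θ.cell φ.cell ψ.cell)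

@[ext]
theorem hom₂_ext {X Y : M.Alg} {f g : Hom X Y} {θ φ : f ⟶ g} (h : θ.cell = φ.cell) : θ = φ :=
  Hom₂.ext h

@[simp]
theorem id_cell {X Y : M.Alg} (f : Hom X Y) : Hom₂.cell (𝟙 f) = 𝟙 f.mor := rfl

@[simp]
theorem comp_cell {X Y : M.Alg} {f g h : Hom X Y} (θ : f ⟶ g) (φ : g ⟶ h) :
    (θ ≫ φ).cell = θ.cell ≫ φ.cell := rfl

theorem eqToIso_cell {X Y : M.Alg} {f g : Hom X Y} (h : f = g) :
    (eqToIso h).hom.cell = (eqToIso (congrArg Hom.mor h)).hom := by subst h; rfl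

/-- An invertible 2-cell between algebra morphisms whose underlying 2-cell is an identity. -/
def isoOfId {X Y : M.Alg} {f g : Hom X Y} (e : f.mor ≅ g.mor) {k : X.obj ⟶ Y.obj}
    (h : e.hom ≗ 𝟙 k) (h' : e.inv ≗ 𝟙 k) : f ≅ g where
  hom := ⟨e.hom, ((map₂_isId M.T h).id_whiskerRight Y.str).trans
    ((CellEq.id (by have := h.src; subst this; exact f.w)).trans (h.whiskerLeft_id X.str).symm)⟩
  inv := ⟨e.inv, ((map₂_isId M.T h').id_whiskerRight Y.str).trans
    ((CellEq.id (by have := h'.src; subst this; exact g.w)).trans (h'.whiskerLeft_id X.str).symm)⟩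
  hom_inv_id := Hom₂.ext e.hom_inv_id
  inv_hom_id := Hom₂.ext e.inv_hom_id

variable [Strict B]

/-- The 2-category of strict algebras, strict morphisms and their 2-cells. -/
instance : Bicategory M.Alg where
  Hom X Y := Hom X Y
  homCategory X Y := inferInstanceAs (Category (Hom X Y))
  id X := ⟨𝟙 X.obj, by rw [M.T.map_id, Category.id_comp, Category.comp_id]⟩
  comp {X Y Z} f g := ⟨f.mor ≫ g.mor, by
    rw [M.T.map_comp, Category.assoc, g.w, ← Category.assoc, f.w, Category.assoc]⟩
  whiskerLeft {X Y Z} f g h θ := ⟨f.mor ◁ θ.cell, by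
    refine ((map₂_whiskerLeft M.T f.mor θ.cell).whiskerRight rfl).trans ?_
    refine (CellEq.whisker_assoc _ _ _).trans ?_
    refine (CellEq.whiskerLeft rfl θ.w).trans ?_
    refine (CellEq.comp_whiskerLeft _ _ _).symm.trans ?_
    refine CellEq.trans ?_ (CellEq.comp_whiskerLeft _ _ _)
    exact CellEq.whiskerLeft f.w CellEq.rfl⟩
  whiskerRight {X Y Z} f g θ h := ⟨θ.cell ▷ h.mor, by
    refine ((map₂_whiskerRight M.T θ.cell h.mor).whiskerRight rfl).trans ?_
    refine (CellEq.whiskerRight_comp _ _ _).symm.trans ?_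
    refine (CellEq.whiskerRight CellEq.rfl h.w).trans ?_
    refine (CellEq.whiskerRight_comp _ _ _).trans ?_
    exact (θ.w.whiskerRight rfl).trans (CellEq.whisker_assoc _ _ _)⟩
  associator f g h := isoOfId (α_ f.mor g.mor h.mor) (CellEq.assoc_hom _ _ _)
    ((CellEq.assoc_inv _ _ _).isId_congr (Category.assoc _ _ _).symm)
  leftUnitor f := isoOfId (λ_ f.mor) (CellEq.left_hom _) (CellEq.left_inv _)
  rightUnitor f := isoOfId (ρ_ f.mor) (CellEq.right_hom _) (CellEq.right_inv _)
  whiskerLeft_id f g := Hom₂.ext (whiskerLeft_id f.mor g.mor)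
  whiskerLeft_comp f g h i θ φ := Hom₂.ext (whiskerLeft_comp f.mor θ.cell φ.cell)
  id_whiskerLeft θ := Hom₂.ext (id_whiskerLeft θ.cell)
  comp_whiskerLeft f g h i θ := Hom₂.ext (comp_whiskerLeft f.mor g.mor θ.cell)
  id_whiskerRight f g := Hom₂.ext (id_whiskerRight f.mor g.mor)
  comp_whiskerRight θ φ i := Hom₂.ext (comp_whiskerRight θ.cell φ.cell i.mor)
  whiskerRight_id θ := Hom₂.ext (whiskerRight_id θ.cell)
  whiskerRight_comp θ g h := Hom₂.ext (whiskerRight_comp θ.cell g.mor h.mor)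
  whisker_assoc f g g' θ h := Hom₂.ext (whisker_assoc f.mor θ.cell h.mor)
  whisker_exchange θ φ := Hom₂.ext (whisker_exchange θ.cell φ.cell)
  pentagon f g h i := Hom₂.ext (pentagon f.mor g.mor h.mor i.mor)
  triangle f g := Hom₂.ext (triangle f.mor g.mor)

instance : Strict M.Alg where
  id_comp f := Hom.ext (Category.id_comp f.mor)
  comp_id f := Hom.ext (Category.comp_id f.mor)
  assoc f g h := Hom.ext (Category.assoc f.mor g.mor h.mor)
  leftUnitor_eqToIso f := Iso.ext (Hom₂.ext
    ((congrArg Iso.hom (Strict.leftUnitor_eqToIso f.mor)).trans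
      (eqToIso_cell (f := 𝟙 _ ≫ f) (g := f) _).symm))
  rightUnitor_eqToIso f := Iso.ext (Hom₂.ext
    ((congrArg Iso.hom (Strict.rightUnitor_eqToIso f.mor)).trans
      (eqToIso_cell (f := f ≫ 𝟙 _) (g := f) _).symm))
  associator_eqToIso f g h := Iso.ext (Hom₂.ext
    ((congrArg Iso.hom (Strict.associator_eqToIso f.mor g.mor h.mor)).trans
      (eqToIso_cell (f := (f ≫ g) ≫ h) (g := f ≫ g ≫ h) _).symm))

theorem cellEq {X Y : M.Alg} {f g f' g' : X ⟶ Y} {θ : f ⟶ g} {θ' : f' ⟶ g'}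
    (h : θ.cell ≗ θ'.cell) : θ ≗ θ' := by
  obtain rfl : f = f' := Hom.ext h.src
  obtain rfl : g = g' := Hom.ext h.tgt
  exact CellEq.of_eq (Hom₂.ext h.eq)

end TwoMonad.Alg

/-- A 2-monad `(T, μ, η)` is lax idempotent if there is a rari adjunction `μ ⊣ ηT`: a modification
`Γ : 1 ⟶ ηT · μ` such that the whiskerings of `Γ_z` with `η_{T z}` and with `μ_z` are the
identity 2-cells on `η_{T z}` and on `μ_z`. -/
def TwoMonad.IsLaxIdempotent (M : TwoMonad B) : Prop :=
  ∃ Γ : ∀ z : B, 𝟙 (M.T.obj (M.T.obj z)) ⟶ M.mul z ≫ M.unit (M.T.obj z),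
    (∀ {z z' : B} (f : z ⟶ z'),
      M.T.map (M.T.map f) ◁ Γ z' ≗ Γ z ▷ M.T.map (M.T.map f)) ∧
    (∀ z : B, M.unit (M.T.obj z) ◁ Γ z ≗ 𝟙 (M.unit (M.T.obj z))) ∧
    ∀ z : B, Γ z ▷ M.mul z ≗ 𝟙 (M.mul z)

variable {A : Type u₁} [Bicategory.{w₁, v₁} A] [Strict A] [Strict B]

namespace TwoAdjunction

/-- The Eilenberg–Moore comparison 2-functor `a ↦ (G a, G ε_a)` of a 2-adjunction. -/
def comparison (adj : TwoAdjunction A B) : StrictPseudofunctor A adj.monad.Alg :=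
  mkTwoFunctor
    { obj := fun a =>
        { obj := adj.G.obj a
          str := adj.G.map (adj.counit a)
          unit := adj.triangle_G a
          assoc := by
            have h : adj.G.map (adj.counit (adj.F.obj (adj.G.obj a))) ≫
                adj.G.map (adj.counit a) =
                adj.G.map (adj.F.map (adj.G.map (adj.counit a))) ≫ adj.G.map (adj.counit a) := by
              rw [← adj.G.map_comp, ← adj.G.map_comp, adj.counit_naturality]
            exact h }
      map := fun {a b} f =>
        { mor := adj.G.map f
          w := by
            have h : adj.G.map (adj.F.map (adj.G.map f)) ≫ adj.G.map (adj.counit b) =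
                adj.G.map (adj.counit a) ≫ adj.G.map f := by
              rw [← adj.G.map_comp, ← adj.G.map_comp, adj.counit_naturality]
            exact h }
      map₂ := fun θ =>
        { cell := adj.G.map₂ θ
          w := ((map₂_whiskerRight adj.G _ _).symm.trans
            ((adj.counit_naturality₂ θ).map adj.G)).trans (map₂_whiskerLeft _ _ _) }
      map₂_id := fun f => TwoMonad.Alg.Hom₂.ext (adj.G.map₂_id f)
      map₂_comp := fun θ φ => TwoMonad.Alg.Hom₂.ext (adj.G.map₂_comp θ φ) }
    (fun a => TwoMonad.Alg.Hom.ext (adj.G.map_id a))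
    (fun f g => TwoMonad.Alg.Hom.ext (adj.G.map_comp f g))
    (fun f _ _ θ => TwoMonad.Alg.cellEq (map₂_whiskerLeft adj.G f θ))
    (fun θ g => TwoMonad.Alg.cellEq (map₂_whiskerRight adj.G θ g))

/-- The 2-adjunction `F ⊣ G` is lax idempotent if the induced 2-monad is. -/
def IsLaxIdempotent (adj : TwoAdjunction A B) : Prop := adj.monad.IsLaxIdempotent

/-- The right 2-adjoint `G` is 2-premonadic if the Eilenberg–Moore comparison 2-functor is fully
faithful. -/
def IsPremonadic (adj : TwoAdjunction A B) : Prop := IsFullyFaithful adj.comparison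

/-- The right 2-adjoint `G` is a pre-Kock–Zöberlein 2-functor. -/
def IsPreKockZoberlein (adj : TwoAdjunction A B) : Prop :=
  adj.IsLaxIdempotent ∧ adj.IsPremonadic

end TwoAdjunction

end Algebras


/-! ### The lax comma 2-category and the comma 2-category -/

section Comma

variable {C : Type u₁} [Bicategory.{w₁, v₁} C]

/-- Objects of the lax comma 2-category `C // y`: 1-cells with codomain `y`. -/
structure LaxOver (y : C) where
  /-- the underlying object -/
  obj : C
  /-- the 1-cell to the base -/
  arr : obj ⟶ y

namespace LaxOver

variable {y : C}

/-- Morphisms `(w, a) ⟶ (x, b)` of `C // y`: a 1-cell `f : w ⟶ x` and a 2-cell `b f ⟶ a`. -/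
structure Hom (X Y : LaxOver y) where
  /-- the underlying 1-cell -/
  mor : X.obj ⟶ Y.obj
  /-- the 2-cell over the base -/
  cell : mor ≫ Y.arr ⟶ X.arr

/-- 2-cells of `C // y`. -/
@[ext]
structure Hom₂ {X Y : LaxOver y} (f g : Hom X Y) where
  /-- the underlying 2-cell -/
  cell : f.mor ⟶ g.mor
  w : cell ▷ Y.arr ≫ g.cell = f.cell

theorem Hom.ext' {X Y : LaxOver y} {f g : Hom X Y} (hm : f.mor = g.mor)
    (hc : f.cell ≗ g.cell) : f = g := by
  obtain ⟨m, k⟩ := f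
  obtain ⟨m', k'⟩ := g
  dsimp only at hm hc
  subst hm
  rw [hc.eq]

instance (X Y : LaxOver y) : Category (Hom X Y) where
  Hom f g := Hom₂ f g
  id f := ⟨𝟙 f.mor, by rw [id_whiskerRight, Category.id_comp]⟩
  comp θ φ := ⟨θ.cell ≫ φ.cell, by rw [comp_whiskerRight, Category.assoc, φ.w, θ.w]⟩
  id_comp θ := Hom₂.ext (Category.id_comp θ.cell)
  comp_id θ := Hom₂.ext (Category.comp_id θ.cell)
  assoc θ φ ψ := Hom₂.ext (Category.assoc θ.cell φ.cell ψ.cell)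

theorem eqToIso_cell {X Y : LaxOver y} {f g : Hom X Y} (h : f = g) :
    (eqToIso h).hom.cell = (eqToIso (congrArg Hom.mor h)).hom := by subst h; rfl

/-- An invertible 2-cell of `C // y` from an invertible 2-cell of `C`. -/
def isoMk {X Y : LaxOver y} {f g : Hom X Y} (e : f.mor ≅ g.mor)
    (h : e.hom ▷ Y.arr ≫ g.cell = f.cell) : f ≅ g where
  hom := ⟨e.hom, h⟩
  inv := ⟨e.inv, by rw [← h, inv_hom_whiskerRight_assoc]⟩
  hom_inv_id := Hom₂.ext e.hom_inv_id
  inv_hom_id := Hom₂.ext e.inv_hom_id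

/-- The lax comma 2-category `C // y`. The composite of `(f, β)` and `(g, χ)` is `g f` with the
pasting `β · (χ f)`. -/
instance : Bicategory (LaxOver y) where
  Hom X Y := Hom X Y
  homCategory X Y := inferInstanceAs (Category (Hom X Y))
  id X := ⟨𝟙 X.obj, (λ_ X.arr).hom⟩
  comp {X Y Z} f g := ⟨f.mor ≫ g.mor, (α_ f.mor g.mor Z.arr).hom ≫ f.mor ◁ g.cell ≫ f.cell⟩
  whiskerLeft {X Y Z} f g h θ := ⟨f.mor ◁ θ.cell, by
    rw [← θ.w]; simp⟩
  whiskerRight {X Y Z} f g θ h := ⟨θ.cell ▷ h.mor, by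
    rw [← θ.w]; simp [whisker_exchange_assoc]⟩
  associator f g h := isoMk (α_ f.mor g.mor h.mor) (by simp)
  leftUnitor f := isoMk (λ_ f.mor) (by simp)
  rightUnitor f := isoMk (ρ_ f.mor) (by simp)
  whiskerLeft_id f g := Hom₂.ext (whiskerLeft_id f.mor g.mor)
  whiskerLeft_comp f g h i θ φ := Hom₂.ext (whiskerLeft_comp f.mor θ.cell φ.cell)
  id_whiskerLeft θ := Hom₂.ext (id_whiskerLeft θ.cell)
  comp_whiskerLeft f g h i θ := Hom₂.ext (comp_whiskerLeft f.mor g.mor θ.cell)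
  id_whiskerRight f g := Hom₂.ext (id_whiskerRight f.mor g.mor)
  comp_whiskerRight θ φ i := Hom₂.ext (comp_whiskerRight θ.cell φ.cell i.mor)
  whiskerRight_id θ := Hom₂.ext (whiskerRight_id θ.cell)
  whiskerRight_comp θ g h := Hom₂.ext (whiskerRight_comp θ.cell g.mor h.mor)
  whisker_assoc f g g' θ h := Hom₂.ext (whisker_assoc f.mor θ.cell h.mor)
  whisker_exchange θ φ := Hom₂.ext (whisker_exchange θ.cell φ.cell)
  pentagon f g h i := Hom₂.ext (pentagon f.mor g.mor h.mor i.mor)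
  triangle f g := Hom₂.ext (triangle f.mor g.mor)

theorem cellEq {X Y : LaxOver y} {f g f' g' : X ⟶ Y} {θ : f ⟶ g} {θ' : f' ⟶ g'}
    (hf : f = f') (hg : g = g') (h : θ.cell ≗ θ'.cell) : θ ≗ θ' := by
  subst hf hg
  exact CellEq.of_eq (Hom₂.ext h.eq)

variable [Strict C]

theorem comp_cell {X Y Z : LaxOver y} (f : X ⟶ Y) (g : Y ⟶ Z) :
    (f ≫ g).cell ≗ f.mor ◁ g.cell ≫ f.cell :=
  CellEq.id_comp (CellEq.assoc_hom _ _ _)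

theorem comp_cell_left {X Y Z : LaxOver y} (f : X ⟶ Y) (g : Y ⟶ Z) {k : X.obj ⟶ y}
    (h : f.cell ≗ 𝟙 k) : (f ≫ g).cell ≗ f.mor ◁ g.cell :=
  (comp_cell f g).trans (CellEq.comp_id h)

theorem comp_cell_right {X Y Z : LaxOver y} (f : X ⟶ Y) (g : Y ⟶ Z) {k : Y.obj ⟶ y}
    (h : g.cell ≗ 𝟙 k) : (f ≫ g).cell ≗ f.cell :=
  (comp_cell f g).trans (CellEq.id_comp (h.whiskerLeft_id f.mor))

theorem id_cell (X : LaxOver y) : Hom.cell (𝟙 X) ≗ 𝟙 X.arr := CellEq.left_hom _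

instance : Strict (LaxOver y) where
  id_comp f := Hom.ext' (Category.id_comp f.mor) ((comp_cell _ _).trans
    ((CellEq.comp_id (id_cell _)).trans (CellEq.id_whiskerLeft _)))
  comp_id f := Hom.ext' (Category.comp_id f.mor) ((comp_cell _ _).trans
    (CellEq.id_comp ((id_cell _).whiskerLeft_id _)))
  assoc f g h := Hom.ext' (Category.assoc f.mor g.mor h.mor) (by
    refine (comp_cell _ _).trans (CellEq.trans ?_ (comp_cell _ _).symm)
    refine (CellEq.comp (CellEq.comp_whiskerLeft f.mor g.mor h.cell) (comp_cell f g)).trans ?_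
    refine CellEq.trans ?_ (CellEq.comp (CellEq.whiskerLeft rfl (comp_cell g h)) CellEq.rfl).symm
    rw [whiskerLeft_comp, Category.assoc]
    exact CellEq.rfl)
  leftUnitor_eqToIso f := Iso.ext (Hom₂.ext
    ((congrArg Iso.hom (Strict.leftUnitor_eqToIso f.mor)).trans
      (eqToIso_cell (f := 𝟙 _ ≫ f) (g := f) _).symm))
  rightUnitor_eqToIso f := Iso.ext (Hom₂.ext
    ((congrArg Iso.hom (Strict.rightUnitor_eqToIso f.mor)).trans
      (eqToIso_cell (f := f ≫ 𝟙 _) (g := f) _).symm))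
  associator_eqToIso f g h := Iso.ext (Hom₂.ext
    ((congrArg Iso.hom (Strict.associator_eqToIso f.mor g.mor h.mor)).trans
      (eqToIso_cell (f := (f ≫ g) ≫ h) (g := f ≫ g ≫ h) _).symm))

end LaxOver

/-- Objects of the comma 2-category `C / y`: the same as those of `C // y`. -/
structure StrictOver (y : C) where
  /-- the object, as an object of `C // y` -/
  lax : LaxOver y

namespace StrictOver

variable {y : C}

/-- Morphisms of `C / y`: the morphisms of `C // y` whose 2-cell is an identity. -/
@[ext]
structure Hom (X Y : StrictOver y) where
  /-- the underlying morphism of `C // y` -/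
  lax : X.lax ⟶ Y.lax
  isId : lax.cell ≗ 𝟙 X.lax.arr

/-- 2-cells of `C / y`: all 2-cells of `C // y` between the given morphisms. -/
instance (X Y : StrictOver y) : Category (Hom X Y) where
  Hom f g := f.lax ⟶ g.lax
  id f := 𝟙 f.lax
  comp θ φ := θ ≫ φ
  id_comp θ := Category.id_comp (X := Hom.lax _) θ
  comp_id θ := Category.comp_id (X := Hom.lax _) θ
  assoc θ φ ψ := Category.assoc (W := Hom.lax _) θ φ ψ

/-- An isomorphism of `C / y` from one of `C // y`. -/
def isoMk {X Y : StrictOver y} {f g : Hom X Y} (e : f.lax ≅ g.lax) : f ≅ g where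
  hom := e.hom
  inv := e.inv
  hom_inv_id := e.hom_inv_id
  inv_hom_id := e.inv_hom_id

theorem eqToIso_lax {X Y : StrictOver y} {f g : Hom X Y} (h : f = g) :
    (eqToIso h).hom = (eqToIso (congrArg Hom.lax h)).hom := by subst h; rfl

variable [Strict C]

/-- The comma 2-category `C / y`, a locally full wide sub-2-category of `C // y`. -/
instance : Bicategory (StrictOver y) where
  Hom X Y := Hom X Y
  homCategory X Y := inferInstanceAs (Category (Hom X Y))
  id X := ⟨𝟙 X.lax, LaxOver.id_cell X.lax⟩
  comp f g := ⟨f.lax ≫ g.lax, (LaxOver.comp_cell f.lax g.lax).trans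
    ((CellEq.id_comp (g.isId.whiskerLeft_id f.lax.mor)).trans f.isId)⟩
  whiskerLeft f g h θ := whiskerLeft f.lax (g := g.lax) (h := h.lax) θ
  whiskerRight {_ _ _ f g} θ h := whiskerRight (f := f.lax) (g := g.lax) θ h.lax
  associator f g h := isoMk (α_ f.lax g.lax h.lax)
  leftUnitor f := isoMk (λ_ f.lax)
  rightUnitor f := isoMk (ρ_ f.lax)
  whiskerLeft_id f g := whiskerLeft_id f.lax g.lax
  whiskerLeft_comp f g h i θ φ := whiskerLeft_comp f.lax (g := g.lax) (h := h.lax) (i := i.lax) θ φ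
  id_whiskerLeft {_ _ f g} θ := id_whiskerLeft (f := f.lax) (g := g.lax) θ
  comp_whiskerLeft f g h i θ := comp_whiskerLeft f.lax g.lax (h := h.lax) (h' := i.lax) θ
  id_whiskerRight f g := id_whiskerRight f.lax g.lax
  comp_whiskerRight {_ _ _ f g h} θ φ i :=
    comp_whiskerRight (f := f.lax) (g := g.lax) (h := h.lax) θ φ i.lax
  whiskerRight_id {_ _ f g} θ := whiskerRight_id (f := f.lax) (g := g.lax) θ
  whiskerRight_comp {_ _ _ _ f f'} θ g h :=
    whiskerRight_comp (f := f.lax) (f' := f'.lax) θ g.lax h.lax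
  whisker_assoc f g g' θ h := whisker_assoc f.lax (g := g.lax) (g' := g'.lax) θ h.lax
  whisker_exchange {_ _ _ f g h i} θ φ :=
    whisker_exchange (f := f.lax) (g := g.lax) (h := h.lax) (i := i.lax) θ φ
  pentagon f g h i := pentagon f.lax g.lax h.lax i.lax
  triangle f g := triangle f.lax g.lax

instance : Strict (StrictOver y) where
  id_comp f := Hom.ext (Category.id_comp f.lax)
  comp_id f := Hom.ext (Category.comp_id f.lax)
  assoc f g h := Hom.ext (Category.assoc f.lax g.lax h.lax)
  leftUnitor_eqToIso f := Iso.ext ((congrArg Iso.hom (Strict.leftUnitor_eqToIso f.lax)).trans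
      (eqToIso_lax (f := 𝟙 _ ≫ f) (g := f) _).symm)
  rightUnitor_eqToIso f := Iso.ext ((congrArg Iso.hom (Strict.rightUnitor_eqToIso f.lax)).trans
      (eqToIso_lax (f := f ≫ 𝟙 _) (g := f) _).symm)
  associator_eqToIso f g h := Iso.ext
    ((congrArg Iso.hom (Strict.associator_eqToIso f.lax g.lax h.lax)).trans
      (eqToIso_lax (f := (f ≫ g) ≫ h) (g := f ≫ g ≫ h) _).symm)

theorem cellEq {X Y : StrictOver y} {f g f' g' : X ⟶ Y} {θ : f ⟶ g} {θ' : f' ⟶ g'}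
    (hf : f = f') (hg : g = g')
    (h : LaxOver.Hom₂.cell (f := f.lax) (g := g.lax) θ ≗
      LaxOver.Hom₂.cell (f := f'.lax) (g := g'.lax) θ') : θ ≗ θ' := by
  subst hf hg
  exact CellEq.of_eq (LaxOver.Hom₂.ext h.eq)

/-- The inclusion 2-functor `C / y ⟶ C // y`. -/
def inclusion (y : C) : StrictPseudofunctor (StrictOver y) (LaxOver y) :=
  mkTwoFunctor
    { obj := fun X => X.lax
      map := fun f => f.lax
      map₂ := fun θ => θ
      map₂_id := fun _ => rfl
      map₂_comp := fun _ _ => rfl }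
    (fun _ => rfl) (fun _ _ => rfl) (fun _ _ _ _ => CellEq.rfl) (fun _ _ => CellEq.rfl)

end StrictOver

namespace LaxOver

variable [Strict C]

/-- The action of the direct image 2-functor on 1-cells. -/
def directImageMap {y z : C} (c : y ⟶ z) {X Y : LaxOver y} (f : X ⟶ Y) :
    (⟨X.obj, X.arr ≫ c⟩ : LaxOver z) ⟶ ⟨Y.obj, Y.arr ≫ c⟩ :=
  ⟨f.mor, (α_ f.mor Y.arr c).inv ≫ f.cell ▷ c⟩

theorem directImageMap_cell {y z : C} (c : y ⟶ z) {X Y : LaxOver y} (f : X ⟶ Y) :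
    (directImageMap c f).cell ≗ f.cell ▷ c :=
  CellEq.id_comp (CellEq.assoc_inv _ _ _)

theorem directImageMap_comp {y z : C} (c : y ⟶ z) {X Y Z : LaxOver y} (f : X ⟶ Y) (g : Y ⟶ Z) :
    directImageMap c (f ≫ g) = directImageMap c f ≫ directImageMap c g :=
  Hom.ext' rfl (by
    refine (directImageMap_cell _ _).trans ?_
    refine ((comp_cell f g).whiskerRight rfl).trans ?_
    rw [comp_whiskerRight]
    refine CellEq.trans ?_ (comp_cell (directImageMap c f) (directImageMap c g)).symm
    refine CellEq.comp ?_ (directImageMap_cell c f).symm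
    refine (CellEq.whisker_assoc _ _ _).trans ?_
    exact CellEq.whiskerLeft rfl (directImageMap_cell c g).symm)

/-- The action of the direct image 2-functor on 2-cells. -/
def directImageMap₂ {y z : C} (c : y ⟶ z) {X Y : LaxOver y} {f g : X ⟶ Y} (θ : f ⟶ g) :
    directImageMap c f ⟶ directImageMap c g :=
  ⟨θ.cell, by
    have h : θ.cell ▷ (Y.arr ≫ c) ≫ (α_ g.mor Y.arr c).inv ≫ g.cell ▷ c =
        (α_ f.mor Y.arr c).inv ≫ f.cell ▷ c := by
      rw [← θ.w]; simp
    exact h⟩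

/-- The direct image 2-functor `C // y ⟶ C // z` given by composition with `c : y ⟶ z`. -/
def directImage {y z : C} (c : y ⟶ z) : StrictPseudofunctor (LaxOver y) (LaxOver z) :=
  mkTwoFunctor
    { obj := fun X => ⟨X.obj, X.arr ≫ c⟩
      map := fun f => directImageMap c f
      map₂ := fun θ => directImageMap₂ c θ
      map₂_id := fun _ => rfl
      map₂_comp := fun _ _ => rfl }
    (fun X => Hom.ext' rfl ((directImageMap_cell c (𝟙 X)).trans
      (((id_cell X).id_whiskerRight c).trans
        (id_cell (⟨X.obj, X.arr ≫ c⟩ : LaxOver z)).symm)))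
    (fun f g => directImageMap_comp c f g)
    (fun _ _ _ _ => cellEq (directImageMap_comp _ _ _) (directImageMap_comp _ _ _) CellEq.rfl)
    (fun _ _ => cellEq (directImageMap_comp _ _ _) (directImageMap_comp _ _ _) CellEq.rfl)

section Lift

variable {A : Type u₁} [Bicategory.{w₁, v₁} A] {B : Type u₂} [Bicategory.{w₂, v₂} B]

/-- The action of the lifting of `H` to lax comma 2-categories on 1-cells. -/
def liftMap (H : StrictPseudofunctor A B) {x : A} {X Y : LaxOver x} (f : X ⟶ Y) :
    (⟨H.obj X.obj, H.map X.arr⟩ : LaxOver (H.obj x)) ⟶ ⟨H.obj Y.obj, H.map Y.arr⟩ :=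
  ⟨H.map f.mor, eqToHom (H.map_comp f.mor Y.arr).symm ≫ H.map₂ f.cell⟩

theorem liftMap_cell (H : StrictPseudofunctor A B) {x : A} {X Y : LaxOver x} (f : X ⟶ Y) :
    (liftMap H f).cell ≗ H.map₂ f.cell :=
  CellEq.eqToHom_comp _ _

/-- The action of the lifting of `H` to lax comma 2-categories on 2-cells. -/
def liftMap₂ (H : StrictPseudofunctor A B) {x : A} {X Y : LaxOver x} {f g : X ⟶ Y} (θ : f ⟶ g) :
    liftMap H f ⟶ liftMap H g :=
  ⟨H.map₂ θ.cell, CellEq.eq (by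
    refine CellEq.trans ?_ (liftMap_cell H f).symm
    rw [← θ.w, H.map₂_comp]
    exact (map₂_whiskerRight H _ _).symm.comp (liftMap_cell H g))⟩

variable [Strict A] [Strict B]

theorem liftMap_comp (H : StrictPseudofunctor A B) {x : A} {X Y Z : LaxOver x} (f : X ⟶ Y)
    (g : Y ⟶ Z) : liftMap H (f ≫ g) = liftMap H f ≫ liftMap H g :=
  Hom.ext' (H.map_comp f.mor g.mor) (by
    refine (liftMap_cell _ _).trans ?_
    refine ((comp_cell f g).map H).trans ?_
    rw [H.map₂_comp]
    refine CellEq.trans ?_ (comp_cell (liftMap H f) (liftMap H g)).symm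
    refine CellEq.comp ?_ (liftMap_cell H f).symm
    refine (map₂_whiskerLeft _ _ _).trans ?_
    exact CellEq.whiskerLeft rfl (liftMap_cell H g).symm)

/-- The 2-functor `A // x ⟶ B // H x` defined pointwise by a 2-functor `H : A ⟶ B`. -/
def lift (H : StrictPseudofunctor A B) (x : A) :
    StrictPseudofunctor (LaxOver x) (LaxOver (H.obj x)) :=
  mkTwoFunctor
    { obj := fun X => ⟨H.obj X.obj, H.map X.arr⟩
      map := fun f => liftMap H f
      map₂ := fun θ => liftMap₂ H θ
      map₂_id := fun f => Hom₂.ext (H.map₂_id f.mor)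
      map₂_comp := fun θ φ => Hom₂.ext (H.map₂_comp θ.cell φ.cell) }
    (fun X => Hom.ext' (H.map_id X.obj) ((liftMap_cell H (𝟙 X)).trans
      ((map₂_isId H (id_cell X)).trans
        (id_cell (⟨H.obj X.obj, H.map X.arr⟩ : LaxOver (H.obj x))).symm)))
    (fun f g => liftMap_comp H f g)
    (fun f _ _ θ => cellEq (liftMap_comp _ _ _) (liftMap_comp _ _ _)
      (map₂_whiskerLeft H f.mor θ.cell))
    (fun θ g => cellEq (liftMap_comp _ _ _) (liftMap_comp _ _ _)
      (map₂_whiskerRight H θ.cell g.mor))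

/-- The component of the counit of the lifted 2-adjunction. -/
def liftCounit (adj : TwoAdjunction A B) {y : A} (X : LaxOver y) :
    (⟨adj.F.obj (adj.G.obj X.obj), adj.F.map (adj.G.map X.arr) ≫ adj.counit y⟩ : LaxOver y) ⟶ X :=
  ⟨adj.counit X.obj, eqToHom (adj.counit_naturality X.arr).symm⟩

theorem liftCounit_isId (adj : TwoAdjunction A B) {y : A} (X : LaxOver y) :
    (liftCounit adj X).cell ≗ 𝟙 (adj.counit X.obj ≫ X.arr) :=
  CellEq.eqToHom (adj.counit_naturality X.arr).symm

theorem liftUnit_eq (adj : TwoAdjunction A B) {y : A} (X : LaxOver (adj.G.obj y)) :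
    adj.unit X.obj ≫ adj.G.map (adj.F.map X.arr ≫ adj.counit y) = X.arr := by
  rw [adj.G.map_comp, ← Category.assoc, ← adj.unit_naturality, Category.assoc, adj.triangle_G,
    Category.comp_id]

/-- The component of the unit of the lifted 2-adjunction. -/
def liftUnit (adj : TwoAdjunction A B) {y : A} (X : LaxOver (adj.G.obj y)) :
    X ⟶ ⟨adj.G.obj (adj.F.obj X.obj), adj.G.map (adj.F.map X.arr ≫ adj.counit y)⟩ :=
  ⟨adj.unit X.obj, eqToHom (liftUnit_eq adj X)⟩

theorem liftUnit_isId (adj : TwoAdjunction A B) {y : A} (X : LaxOver (adj.G.obj y)) :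
    (liftUnit adj X).cell ≗ 𝟙 X.arr :=
  (CellEq.eqToHom (liftUnit_eq adj X)).trans (CellEq.id (liftUnit_eq adj X))

theorem liftCounit_naturality (adj : TwoAdjunction A B) {y : A} {X Y : LaxOver y} (f : X ⟶ Y) :
    directImageMap (adj.counit y) (liftMap adj.F (liftMap adj.G f)) ≫ liftCounit adj Y =
      liftCounit adj X ≫ f :=
  Hom.ext' (adj.counit_naturality f.mor) (by
    refine (comp_cell_right _ (liftCounit adj Y) (liftCounit_isId adj Y)).trans
      (CellEq.trans ?_ (comp_cell_left (liftCounit adj X) f (liftCounit_isId adj X)).symm)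
    refine (directImageMap_cell _ _).trans ?_
    refine (CellEq.whiskerRight ((liftMap_cell adj.F (liftMap adj.G f)).trans
      ((liftMap_cell adj.G f).map adj.F)) rfl).trans ?_
    exact adj.counit_naturality₂ f.cell)

theorem liftUnit_naturality (adj : TwoAdjunction A B) {y : A} {X Y : LaxOver (adj.G.obj y)}
    (f : X ⟶ Y) :
    f ≫ liftUnit adj Y =
      liftUnit adj X ≫ liftMap adj.G (directImageMap (adj.counit y) (liftMap adj.F f)) :=
  Hom.ext' (adj.unit_naturality f.mor) (by
    refine (comp_cell_right f (liftUnit adj Y) (liftUnit_isId adj Y)).trans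
      (CellEq.trans ?_ (comp_cell_left (liftUnit adj X) _ (liftUnit_isId adj X)).symm)
    refine CellEq.trans ?_ (CellEq.whiskerLeft rfl ((liftMap_cell adj.G _).trans
      (((directImageMap_cell _ _).trans ((liftMap_cell adj.F f).whiskerRight rfl)).map
        adj.G)).symm)
    refine CellEq.trans ?_ (CellEq.whiskerLeft rfl (map₂_whiskerRight _ _ _)).symm
    refine CellEq.trans ?_ (CellEq.whisker_assoc _ _ _)
    refine CellEq.trans ?_ ((adj.unit_naturality₂ f.cell).whiskerRight rfl)
    refine CellEq.trans ?_ (CellEq.whiskerRight_comp _ _ _)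
    refine CellEq.trans ?_ (CellEq.whiskerRight CellEq.rfl (adj.triangle_G y).symm)
    exact (CellEq.whiskerRight_id _).symm)

/-- The lifting `ε_y! ∘ F ⊣ G : A // y ⟶ B // G y` of a 2-adjunction `F ⊣ G : A ⟶ B` to the lax
comma 2-categories; its counit and unit are given pointwise by those of `F ⊣ G`. -/
def liftAdjunction (adj : TwoAdjunction A B) (y : A) :
    TwoAdjunction (LaxOver y) (LaxOver (adj.G.obj y)) where
  F := (lift adj.F (adj.G.obj y)).comp (directImage (adj.counit y))
  G := lift adj.G y
  counit X := liftCounit adj X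
  counit_naturality f := liftCounit_naturality adj f
  counit_naturality₂ θ := cellEq (liftCounit_naturality adj _) (liftCounit_naturality adj _)
    (adj.counit_naturality₂ θ.cell)
  unit X := liftUnit adj X
  unit_naturality f := liftUnit_naturality adj f
  unit_naturality₂ θ := cellEq (liftUnit_naturality adj _) (liftUnit_naturality adj _)
    (adj.unit_naturality₂ θ.cell)
  triangle_F X := Hom.ext' (adj.triangle_F X.obj) (by
    refine (comp_cell_right _ _ (liftCounit_isId adj _)).trans ?_
    refine (directImageMap_cell _ _).trans ?_
    refine (CellEq.whiskerRight ((liftMap_cell adj.F _).trans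
      (map₂_isId adj.F (liftUnit_isId adj X))) rfl).trans ?_
    refine (CellEq.id_whiskerRight CellEq.rfl _).trans ?_
    exact (id_cell (⟨adj.F.obj X.obj, adj.F.map X.arr ≫ adj.counit y⟩ : LaxOver y)).symm)
  triangle_G X := Hom.ext' (adj.triangle_G X.obj) (by
    refine (comp_cell_left _ _ (liftUnit_isId adj _)).trans ?_
    refine (CellEq.whiskerLeft rfl ((liftMap_cell adj.G _).trans
      (map₂_isId adj.G (liftCounit_isId adj X)))).trans ?_
    refine (CellEq.whiskerLeft_id _ CellEq.rfl).trans ?_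
    refine CellEq.trans (CellEq.id ?_)
      (id_cell (⟨adj.G.obj X.obj, adj.G.map X.arr⟩ : LaxOver (adj.G.obj y))).symm
    have h : adj.unit (adj.G.obj X.obj) ≫ adj.G.map (adj.counit X.obj ≫ X.arr) =
        adj.G.map X.arr := by
      rw [adj.G.map_comp, ← Category.assoc, adj.triangle_G, Category.id_comp]
    exact h)

end Lift

end LaxOver

/-! ### Comma objects and the change of base 2-functor -/

/-- A comma object `a ↓ b` in the 2-category `C`. -/
structure CommaObject {x w y : C} (a : x ⟶ y) (b : w ⟶ y) where
  /-- the comma object -/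
  pt : C
  /-- the projection to the domain of `a` -/
  fst : pt ⟶ x
  /-- the projection to the domain of `b` -/
  snd : pt ⟶ w
  /-- the universal 2-cell -/
  cell : fst ≫ a ⟶ snd ≫ b
  /-- the 1-cell induced by the 1-dimensional universal property -/
  lift {z : C} (h₀ : z ⟶ x) (h₁ : z ⟶ w) (θ : h₀ ≫ a ⟶ h₁ ≫ b) : z ⟶ pt
  lift_fst {z : C} (h₀ : z ⟶ x) (h₁ : z ⟶ w) (θ : h₀ ≫ a ⟶ h₁ ≫ b) : lift h₀ h₁ θ ≫ fst = h₀
  lift_snd {z : C} (h₀ : z ⟶ x) (h₁ : z ⟶ w) (θ : h₀ ≫ a ⟶ h₁ ≫ b) : lift h₀ h₁ θ ≫ snd = h₁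
  lift_cell {z : C} (h₀ : z ⟶ x) (h₁ : z ⟶ w) (θ : h₀ ≫ a ⟶ h₁ ≫ b) : lift h₀ h₁ θ ◁ cell ≗ θ
  hom_ext {z : C} {h h' : z ⟶ pt} (h_fst : h ≫ fst = h' ≫ fst) (h_snd : h ≫ snd = h' ≫ snd)
    (h_cell : h ◁ cell ≗ h' ◁ cell) : h = h'
  /-- the 2-cell induced by the 2-dimensional universal property -/
  lift₂ {z : C} {h h' : z ⟶ pt} (ξ₀ : h ≫ fst ⟶ h' ≫ fst) (ξ₁ : h ≫ snd ⟶ h' ≫ snd)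
    (w : ξ₀ ▷ a ≫ (α_ h' fst a).hom ≫ h' ◁ cell =
      (α_ h fst a).hom ≫ h ◁ cell ≫ (α_ h snd b).inv ≫ ξ₁ ▷ b ≫ (α_ h' snd b).hom) : h ⟶ h'
  lift₂_fst {z : C} {h h' : z ⟶ pt} (ξ₀ : h ≫ fst ⟶ h' ≫ fst) (ξ₁ : h ≫ snd ⟶ h' ≫ snd)
    (w : ξ₀ ▷ a ≫ (α_ h' fst a).hom ≫ h' ◁ cell =
      (α_ h fst a).hom ≫ h ◁ cell ≫ (α_ h snd b).inv ≫ ξ₁ ▷ b ≫ (α_ h' snd b).hom) :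
    lift₂ ξ₀ ξ₁ w ▷ fst = ξ₀
  lift₂_snd {z : C} {h h' : z ⟶ pt} (ξ₀ : h ≫ fst ⟶ h' ≫ fst) (ξ₁ : h ≫ snd ⟶ h' ≫ snd)
    (w : ξ₀ ▷ a ≫ (α_ h' fst a).hom ≫ h' ◁ cell =
      (α_ h fst a).hom ≫ h ◁ cell ≫ (α_ h snd b).inv ≫ ξ₁ ▷ b ≫ (α_ h' snd b).hom) :
    lift₂ ξ₀ ξ₁ w ▷ snd = ξ₁
  cell_ext {z : C} {h h' : z ⟶ pt} {ξ ξ' : h ⟶ h'} (h_fst : ξ ▷ fst = ξ' ▷ fst)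
    (h_snd : ξ ▷ snd = ξ' ▷ snd) : ξ = ξ'

/-- A choice of comma objects `b ↓ c` along `c : y ⟶ z`, for all 1-cells `b` with codomain `z`. -/
def CommaObjectsAlong {y z : C} (c : y ⟶ z) :=
  ∀ X : LaxOver z, CommaObject X.arr c

namespace StrictOver

variable [Strict C] {y z : C}

/-- The morphism of `C / y` given by a 1-cell over `y`. -/
def homMk {X Y : StrictOver y} (f : X.lax.obj ⟶ Y.lax.obj) (h : f ≫ Y.lax.arr = X.lax.arr) :
    X ⟶ Y :=
  ⟨⟨f, eqToHom h⟩, (CellEq.eqToHom h).trans (CellEq.id h)⟩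

theorem hom_ext {X Y : StrictOver y} {f g : X ⟶ Y} (h : f.lax.mor = g.lax.mor) : f = g :=
  Hom.ext (LaxOver.Hom.ext' h (f.isId.trans g.isId.symm))

variable {c : y ⟶ z} (K : CommaObjectsAlong c)

/-- The object `(b ↓ c, c^⇐(b))` of `C / y`, for an object `(x, b)` of `C // z`. -/
def commaObj (X : LaxOver z) : StrictOver y := ⟨⟨(K X).pt, (K X).snd⟩⟩

/-- The underlying 1-cell of the morphism `c^⇐(f, β)`. -/
def commaMor {X Y : LaxOver z} (f : X ⟶ Y) : (K X).pt ⟶ (K Y).pt :=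
  (K Y).lift ((K X).fst ≫ f.mor) (K X).snd
    ((α_ (K X).fst f.mor Y.arr).hom ≫ (K X).fst ◁ f.cell ≫ (K X).cell)

theorem commaMor_fst {X Y : LaxOver z} (f : X ⟶ Y) :
    commaMor K f ≫ (K Y).fst = (K X).fst ≫ f.mor := (K Y).lift_fst _ _ _

theorem commaMor_snd {X Y : LaxOver z} (f : X ⟶ Y) :
    commaMor K f ≫ (K Y).snd = (K X).snd := (K Y).lift_snd _ _ _

theorem commaMor_cell {X Y : LaxOver z} (f : X ⟶ Y) :
    commaMor K f ◁ (K Y).cell ≗ (K X).fst ◁ f.cell ≫ (K X).cell :=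
  ((K Y).lift_cell _ _ _).trans (CellEq.id_comp (CellEq.assoc_hom _ _ _))

theorem commaMor_id (X : LaxOver z) : commaMor K (𝟙 X) = 𝟙 (K X).pt := by
  refine (K X).hom_ext ?_ ?_ ?_
  · rw [commaMor_fst, Category.id_comp]
    exact Category.comp_id _
  · rw [commaMor_snd, Category.id_comp]
  · exact (commaMor_cell K (𝟙 X)).trans ((CellEq.id_comp ((LaxOver.id_cell X).whiskerLeft_id _)).trans
      (CellEq.id_whiskerLeft _).symm)

theorem commaMor_comp {W X Y : LaxOver z} (f : W ⟶ X) (g : X ⟶ Y) :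
    commaMor K (f ≫ g) = commaMor K f ≫ commaMor K g := by
  refine (K Y).hom_ext ?_ ?_ ?_
  · rw [commaMor_fst, Category.assoc, commaMor_fst, ← Category.assoc, commaMor_fst, Category.assoc]
    rfl
  · rw [commaMor_snd, Category.assoc, commaMor_snd, commaMor_snd]
  · refine (commaMor_cell K (f ≫ g)).trans ?_
    refine CellEq.trans ?_ (CellEq.comp_whiskerLeft _ _ _).symm
    refine CellEq.trans ?_ (CellEq.whiskerLeft rfl (commaMor_cell K g)).symm
    rw [whiskerLeft_comp]
    refine CellEq.trans ?_ (CellEq.comp (((CellEq.comp_whiskerLeft _ _ _).symm.trans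
      (CellEq.whiskerLeft (commaMor_fst K f) CellEq.rfl)).trans (CellEq.comp_whiskerLeft _ _ _))
      (commaMor_cell K f)).symm
    refine (CellEq.comp (CellEq.whiskerLeft rfl (LaxOver.comp_cell f g)) CellEq.rfl).trans ?_
    rw [whiskerLeft_comp, Category.assoc]
    exact CellEq.rfl

/-- The action of `c^⇐` on 1-cells. -/
def commaMap {X Y : LaxOver z} (f : X ⟶ Y) : commaObj K X ⟶ commaObj K Y :=
  homMk (commaMor K f) (commaMor_snd K f)

theorem commaMor₂_aux {X Y : LaxOver z} {f g : X ⟶ Y} (θ : f ⟶ g) :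
    (eqToHom (commaMor_fst K f) ≫ (K X).fst ◁ θ.cell ≫ eqToHom (commaMor_fst K g).symm) ▷
        Y.arr ≫ (α_ _ _ _).hom ≫ commaMor K g ◁ (K Y).cell =
      (α_ _ _ _).hom ≫ commaMor K f ◁ (K Y).cell ≫ (α_ _ _ _).inv ≫
        eqToHom ((commaMor_snd K f).trans (commaMor_snd K g).symm) ▷ c ≫ (α_ _ _ _).hom := by
  refine CellEq.eq ?_
  have h₁ : (α_ (commaMor K g) (K Y).fst Y.arr).hom ≫ commaMor K g ◁ (K Y).cell ≗
      (α_ (K X).fst g.mor Y.arr).hom ≫ (K X).fst ◁ g.cell ≫ (K X).cell :=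
    (CellEq.id_comp (CellEq.assoc_hom _ _ _)).trans ((commaMor_cell K g).trans
      (CellEq.id_comp (CellEq.assoc_hom _ _ _)).symm)
  refine (CellEq.comp (CellEq.whiskerRight ((CellEq.eqToHom_comp _ _).trans
    (CellEq.comp_eqToHom _ _)) rfl) h₁).trans ?_
  refine (CellEq.comp (CellEq.whisker_assoc _ _ _)
    (CellEq.id_comp (φ := (K X).fst ◁ g.cell ≫ (K X).cell) (CellEq.assoc_hom _ _ _))).trans ?_
  have h₂ : (K X).fst ◁ θ.cell ▷ Y.arr ≫ (K X).fst ◁ g.cell ≫ (K X).cell =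
      (K X).fst ◁ f.cell ≫ (K X).cell := by
    rw [← θ.w, whiskerLeft_comp, Category.assoc]
  refine (CellEq.of_eq h₂).trans ?_
  refine CellEq.trans ?_ (CellEq.id_comp (CellEq.assoc_hom _ _ _)).symm
  refine (commaMor_cell K f).symm.trans ?_
  refine (CellEq.comp_id (θ := commaMor K f ◁ (K Y).cell) (g' := commaMor K f ≫ (K Y).snd ≫ c)
    ?_).symm
  refine (CellEq.id_comp (CellEq.assoc_inv _ _ _)).trans ?_
  refine (CellEq.comp_id (CellEq.assoc_hom _ _ _)).trans ?_
  refine (CellEq.id_whiskerRight (CellEq.eqToHom _) c).trans ?_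
  exact CellEq.id (Category.assoc _ _ _)

/-- The underlying 2-cell of `c^⇐(θ)`. -/
def commaMor₂ {X Y : LaxOver z} {f g : X ⟶ Y} (θ : f ⟶ g) : commaMor K f ⟶ commaMor K g :=
  (K Y).lift₂
    (eqToHom (commaMor_fst K f) ≫ (K X).fst ◁ θ.cell ≫ eqToHom (commaMor_fst K g).symm)
    (eqToHom ((commaMor_snd K f).trans (commaMor_snd K g).symm))
    (commaMor₂_aux K θ)

theorem commaMor₂_fst {X Y : LaxOver z} {f g : X ⟶ Y} (θ : f ⟶ g) :
    commaMor₂ K θ ▷ (K Y).fst ≗ (K X).fst ◁ θ.cell :=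
  (CellEq.of_eq ((K Y).lift₂_fst _ _ _)).trans
    ((CellEq.eqToHom_comp _ _).trans (CellEq.comp_eqToHom _ _))

theorem commaMor₂_snd {X Y : LaxOver z} {f g : X ⟶ Y} (θ : f ⟶ g) :
    commaMor₂ K θ ▷ (K Y).snd ≗ 𝟙 (K X).snd :=
  (CellEq.of_eq ((K Y).lift₂_snd _ _ _)).trans
    ((CellEq.eqToHom _).trans (CellEq.id (commaMor_snd K f)))

/-- 2-cells into a comma object are equal if their whiskerings with the projections are. -/
theorem _root_.TwoDim.CommaObject.cellEq {x w y : C} {a : x ⟶ y} {b : w ⟶ y} (k : CommaObject a b)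
    {z : C} {h h' l l' : z ⟶ k.pt} {ξ : h ⟶ h'} {ξ' : l ⟶ l'} (e : h = l) (e' : h' = l')
    (h_fst : ξ ▷ k.fst ≗ ξ' ▷ k.fst) (h_snd : ξ ▷ k.snd ≗ ξ' ▷ k.snd) : ξ ≗ ξ' := by
  subst e e'
  exact CellEq.of_eq (k.cell_ext h_fst.eq h_snd.eq)

/-- The action of `c^⇐` on 2-cells. -/
def commaMap₂ {X Y : LaxOver z} {f g : X ⟶ Y} (θ : f ⟶ g) : commaMap K f ⟶ commaMap K g :=
  (⟨commaMor₂ K θ, CellEq.eq ((CellEq.comp_id (g' := (K X).snd)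
    ((commaMap K g).isId)).trans ((commaMor₂_snd K θ).trans (commaMap K f).isId.symm))⟩ :
      (commaMap K f).lax ⟶ (commaMap K g).lax)

theorem commaMor₂_comp {X Y : LaxOver z} {f g h : X ⟶ Y} (θ : f ⟶ g) (φ : g ⟶ h) :
    commaMor₂ K (θ ≫ φ) = commaMor₂ K θ ≫ commaMor₂ K φ := by
  refine (K Y).cell_ext (CellEq.eq ?_) (CellEq.eq ?_)
  · rw [comp_whiskerRight]
    refine (commaMor₂_fst K _).trans (CellEq.trans ?_
      ((commaMor₂_fst K θ).comp (commaMor₂_fst K φ)).symm)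
    rw [← whiskerLeft_comp]
    exact CellEq.rfl
  · rw [comp_whiskerRight]
    refine (commaMor₂_snd K _).trans (CellEq.trans ?_
      ((commaMor₂_snd K θ).comp (commaMor₂_snd K φ)).symm)
    rw [Category.id_comp]
    exact CellEq.rfl

theorem commaMor₂_id {X Y : LaxOver z} (f : X ⟶ Y) :
    commaMor₂ K (𝟙 f) = 𝟙 (commaMor K f) := by
  refine (K Y).cell_ext (CellEq.eq ?_) (CellEq.eq ?_)
  · rw [id_whiskerRight]
    refine (commaMor₂_fst K _).trans ?_
    exact (CellEq.whiskerLeft_id (K X).fst (f' := f.mor) CellEq.rfl).trans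
      (CellEq.id (commaMor_fst K f).symm)
  · rw [id_whiskerRight]
    exact (commaMor₂_snd K _).trans (CellEq.id (commaMor_snd K f).symm)

theorem commaMor₂_whiskerLeft {W X Y : LaxOver z} (f : W ⟶ X) {g h : X ⟶ Y} (θ : g ⟶ h) :
    commaMor₂ K (f ◁ θ) ≗ commaMor K f ◁ commaMor₂ K θ := by
  refine (K Y).cellEq (commaMor_comp K f g) (commaMor_comp K f h) ?_ ?_
  · refine (commaMor₂_fst K _).trans (CellEq.trans ?_ (CellEq.whisker_assoc _ _ _).symm)
    refine CellEq.trans ?_ (CellEq.whiskerLeft rfl (commaMor₂_fst K θ)).symm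
    refine CellEq.trans ?_ (CellEq.comp_whiskerLeft _ _ _)
    exact (CellEq.comp_whiskerLeft _ _ _).symm.trans
      (CellEq.whiskerLeft (commaMor_fst K f).symm CellEq.rfl)
  · refine (commaMor₂_snd K _).trans (CellEq.trans ?_ (CellEq.whisker_assoc _ _ _).symm)
    exact ((CellEq.whiskerLeft_id _ (commaMor₂_snd K θ)).trans (CellEq.id (commaMor_snd K f))).symm

theorem commaMor₂_whiskerRight {W X Y : LaxOver z} {f g : W ⟶ X} (θ : f ⟶ g) (h : X ⟶ Y) :
    commaMor₂ K (θ ▷ h) ≗ commaMor₂ K θ ▷ commaMor K h := by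
  refine (K Y).cellEq (commaMor_comp K f h) (commaMor_comp K g h) ?_ ?_
  · refine (commaMor₂_fst K _).trans (CellEq.trans ?_ (CellEq.whiskerRight_comp _ _ _))
    refine CellEq.trans ?_ (CellEq.whiskerRight CellEq.rfl (commaMor_fst K h).symm)
    refine CellEq.trans ?_ (CellEq.whiskerRight_comp _ _ _).symm
    refine CellEq.trans ?_ (CellEq.whiskerRight (commaMor₂_fst K θ).symm rfl)
    exact (CellEq.whisker_assoc _ _ _).symm
  · refine (commaMor₂_snd K _).trans (CellEq.trans ?_ (CellEq.whiskerRight_comp _ _ _))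
    refine CellEq.trans ?_ (CellEq.whiskerRight CellEq.rfl (commaMor_snd K h).symm)
    exact (commaMor₂_snd K θ).symm

/-- The 2-functor `c^⇐ : C // z ⟶ C / y`, given by comma objects along `c : y ⟶ z`. -/
def commaFunctor : StrictPseudofunctor (LaxOver z) (StrictOver y) :=
  mkTwoFunctor
    { obj := fun X => commaObj K X
      map := fun f => commaMap K f
      map₂ := fun θ => commaMap₂ K θ
      map₂_id := fun f => LaxOver.Hom₂.ext (commaMor₂_id K f)
      map₂_comp := fun θ φ => LaxOver.Hom₂.ext (commaMor₂_comp K θ φ) }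
    (fun X => hom_ext (commaMor_id K X))
    (fun f g => hom_ext (commaMor_comp K f g))
    (fun f _ _ θ => cellEq (hom_ext (commaMor_comp K _ _)) (hom_ext (commaMor_comp K _ _))
      (commaMor₂_whiskerLeft K f θ))
    (fun θ g => cellEq (hom_ext (commaMor_comp K _ _)) (hom_ext (commaMor_comp K _ _))
      (commaMor₂_whiskerRight K θ g))

/-- The component of the counit of `c! ⊣ c^⇐`, given by the universal 2-cell. -/
def baseCounit (X : LaxOver z) :
    (⟨(K X).pt, (K X).snd ≫ c⟩ : LaxOver z) ⟶ X :=
  ⟨(K X).fst, (K X).cell⟩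

/-- The object `c!(W)` of `C // z`. -/
abbrev pushObj (c : y ⟶ z) (W : StrictOver y) : LaxOver z := ⟨W.lax.obj, W.lax.arr ≫ c⟩

/-- The underlying 1-cell of the component of the unit of `c! ⊣ c^⇐`. -/
def baseUnitMor (W : StrictOver y) : W.lax.obj ⟶ (K (pushObj c W)).pt :=
  (K (pushObj c W)).lift (𝟙 _) W.lax.arr (λ_ (W.lax.arr ≫ c)).hom

theorem baseUnitMor_fst (W : StrictOver y) :
    baseUnitMor K W ≫ (K (pushObj c W)).fst = 𝟙 _ := (K (pushObj c W)).lift_fst _ _ _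

theorem baseUnitMor_snd (W : StrictOver y) :
    baseUnitMor K W ≫ (K (pushObj c W)).snd = W.lax.arr := (K (pushObj c W)).lift_snd _ _ _

theorem baseUnitMor_cell (W : StrictOver y) :
    baseUnitMor K W ◁ (K (pushObj c W)).cell ≗ 𝟙 (W.lax.arr ≫ c) :=
  ((K (pushObj c W)).lift_cell _ _ _).trans (CellEq.left_hom _)

/-- The component of the unit of `c! ⊣ c^⇐`. -/
def baseUnit (W : StrictOver y) : W ⟶ commaObj K (pushObj c W) :=
  homMk (baseUnitMor K W) (baseUnitMor_snd K W)

theorem pushMap_isId {V W : StrictOver y} (f : V ⟶ W) :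
    (LaxOver.directImageMap c f.lax).cell ≗ 𝟙 (V.lax.arr ≫ c) :=
  (LaxOver.directImageMap_cell c f.lax).trans (f.isId.id_whiskerRight c)

theorem baseCounit_naturality {X Y : LaxOver z} (f : X ⟶ Y) :
    LaxOver.directImageMap c (commaMap K f).lax ≫ baseCounit K Y = baseCounit K X ≫ f :=
  LaxOver.Hom.ext' (commaMor_fst K f) (by
    refine (LaxOver.comp_cell_left _ (baseCounit K Y) (pushMap_isId (commaMap K f))).trans ?_
    exact (commaMor_cell K f).trans (LaxOver.comp_cell (baseCounit K X) f).symm)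

theorem baseUnitMor_naturality {V W : StrictOver y} (f : V ⟶ W) :
    f.lax.mor ≫ baseUnitMor K W =
      baseUnitMor K V ≫ commaMor K (LaxOver.directImageMap c f.lax) := by
  have hf : f.lax.mor ≫ W.lax.arr = V.lax.arr := f.isId.src
  refine (K (pushObj c W)).hom_ext ?_ ?_ ?_
  · rw [Category.assoc, Category.assoc, baseUnitMor_fst, commaMor_fst, ← Category.assoc,
      baseUnitMor_fst, Category.comp_id]
    exact (Category.id_comp f.lax.mor).symm
  · rw [Category.assoc, Category.assoc, baseUnitMor_snd, commaMor_snd, baseUnitMor_snd, hf]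
  · refine (CellEq.comp_whiskerLeft _ _ _).trans (CellEq.trans ?_
      (CellEq.comp_whiskerLeft _ _ _).symm)
    refine (CellEq.whiskerLeft_id _ (baseUnitMor_cell K W)).trans ?_
    refine CellEq.trans ?_ (CellEq.whiskerLeft rfl ((commaMor_cell K _).trans
      (CellEq.id_comp ((pushMap_isId f).whiskerLeft_id _)))).symm
    refine CellEq.trans (CellEq.id ?_) (baseUnitMor_cell K V).symm
    rw [← Category.assoc, hf]

theorem baseUnit_naturality {V W : StrictOver y} (f : V ⟶ W) :
    f ≫ baseUnit K W = baseUnit K V ≫ commaMap K (LaxOver.directImageMap c f.lax) :=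
  hom_ext (baseUnitMor_naturality K f)

theorem baseUnitMor_naturality₂ {V W : StrictOver y} {f g : V.lax ⟶ W.lax} (θ : f ⟶ g)
    (hf : f.cell ≗ 𝟙 V.lax.arr) (hg : g.cell ≗ 𝟙 V.lax.arr) :
    θ.cell ▷ baseUnitMor K W ≗
      baseUnitMor K V ◁ commaMor₂ K (LaxOver.directImageMap₂ c θ) := by
  refine (K (pushObj c W)).cellEq (baseUnitMor_naturality K (⟨f, hf⟩ : V ⟶ W))
    (baseUnitMor_naturality K (⟨g, hg⟩ : V ⟶ W)) ?_ ?_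
  · refine (CellEq.whiskerRight_comp _ _ _).symm.trans (CellEq.trans ?_
      (CellEq.whisker_assoc _ _ _).symm)
    refine (CellEq.whiskerRight CellEq.rfl (baseUnitMor_fst K W)).trans ?_
    refine (CellEq.whiskerRight_id _).trans ?_
    refine CellEq.trans ?_ (CellEq.whiskerLeft rfl (commaMor₂_fst K _)).symm
    refine CellEq.trans ?_ (CellEq.comp_whiskerLeft _ _ _)
    refine CellEq.trans ?_ (CellEq.whiskerLeft (baseUnitMor_fst K V) CellEq.rfl).symm
    exact (CellEq.id_whiskerLeft θ.cell).symm
  · refine (CellEq.whiskerRight_comp _ _ _).symm.trans (CellEq.trans ?_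
      (CellEq.whisker_assoc _ _ _).symm)
    refine (CellEq.whiskerRight CellEq.rfl (baseUnitMor_snd K W)).trans ?_
    refine CellEq.trans ?_ (CellEq.whiskerLeft_id _ (commaMor₂_snd K _)).symm
    refine CellEq.trans ?_ (CellEq.id (baseUnitMor_snd K V)).symm
    exact (CellEq.comp_id hg).symm.trans ((CellEq.of_eq θ.w).trans hf)

/-- The 2-adjunction `c! ⊣ c^⇐ : C // z ⟶ C / y` induced by comma objects along `c : y ⟶ z`. -/
def changeOfBase : TwoAdjunction (LaxOver z) (StrictOver y) where
  F := (inclusion y).comp (LaxOver.directImage c)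
  G := commaFunctor K
  counit X := baseCounit K X
  counit_naturality f := baseCounit_naturality K f
  counit_naturality₂ θ := LaxOver.cellEq (baseCounit_naturality K _) (baseCounit_naturality K _)
    (commaMor₂_fst K θ)
  unit W := baseUnit K W
  unit_naturality f := baseUnit_naturality K f
  unit_naturality₂ {V W f g} θ := cellEq (baseUnit_naturality K f) (baseUnit_naturality K g)
    (baseUnitMor_naturality₂ (V := V) (W := W) (f := f.lax) (g := g.lax) K θ f.isId g.isId)
  triangle_F W := LaxOver.Hom.ext' (baseUnitMor_fst K W) (by
    refine (LaxOver.comp_cell_left _ (baseCounit K (pushObj c W))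
      (pushMap_isId (baseUnit K W))).trans ?_
    exact (baseUnitMor_cell K W).trans (LaxOver.id_cell (pushObj c W)).symm)
  triangle_G X := hom_ext (by
    have h : baseUnitMor K (commaObj K X) ≫ commaMor K (baseCounit K X) = 𝟙 (K X).pt := by
      refine (K X).hom_ext ?_ ?_ ?_
      · refine (Category.assoc _ _ _).trans ?_
        refine (congrArg (fun t => baseUnitMor K (commaObj K X) ≫ t)
          (commaMor_fst K (baseCounit K X))).trans ?_
        refine (Category.assoc _ _ _).symm.trans ?_
        exact congrArg (fun t => t ≫ (K X).fst) (baseUnitMor_fst K (commaObj K X))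
      · refine (Category.assoc _ _ _).trans ?_
        refine (congrArg (fun t => baseUnitMor K (commaObj K X) ≫ t)
          (commaMor_snd K (baseCounit K X))).trans ?_
        exact (baseUnitMor_snd K (commaObj K X)).trans (Category.id_comp _).symm
      · refine (CellEq.comp_whiskerLeft _ _ _).trans (CellEq.trans ?_
          (CellEq.id_whiskerLeft _).symm)
        refine (CellEq.whiskerLeft rfl (commaMor_cell K (baseCounit K X))).trans ?_
        refine (CellEq.of_eq (whiskerLeft_comp (baseUnitMor K (commaObj K X)) _ _)).trans ?_
        refine (CellEq.comp_id (baseUnitMor_cell K (commaObj K X))).trans ?_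
        refine (CellEq.comp_whiskerLeft _ _ _).symm.trans ?_
        refine (CellEq.whiskerLeft (baseUnitMor_fst K (commaObj K X)) CellEq.rfl).trans ?_
        exact CellEq.id_whiskerLeft _
    exact h)

end StrictOver

end Comma

/-! ### Regular epimorphisms -/

section RegularEpi

variable {C : Type u₁} [Bicategory.{w₁, v₁} C]

/-- `f` is the (2-dimensional) coequalizer of `p` and `q`: composition with `f` is an isomorphism
from the category of 1-cells `y ⟶ w` to the category of 1-cells `h : x ⟶ w` with `p ≫ h = q ≫ h`
and of the 2-cells `ξ` between them with `p ◁ ξ = q ◁ ξ`. -/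
def IsCoequalizer {z x y : C} (p q : z ⟶ x) (f : x ⟶ y) : Prop :=
  p ≫ f = q ≫ f ∧
    (∀ {w : C} (h : x ⟶ w), p ≫ h = q ≫ h → ∃! k : y ⟶ w, f ≫ k = h) ∧
    ∀ {w : C} (k k' : y ⟶ w) (ξ : f ≫ k ⟶ f ≫ k'), p ◁ ξ ≗ q ◁ ξ → ∃! ζ : k ⟶ k', f ◁ ζ = ξ

/-- A regular epimorphism in a 2-category: a 1-cell which is the coequalizer of some parallel pair
of 1-cells. -/
def IsRegularEpi {x y : C} (f : x ⟶ y) : Prop :=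
  ∃ (z : C) (p q : z ⟶ x), IsCoequalizer p q f

end RegularEpi

/-! ### Simple and 2-admissible 2-adjunctions -/

namespace TwoAdjunction

variable {A : Type u₁} [Bicategory.{w₁, v₁} A] [Strict A]
  {B : Type u₂} [Bicategory.{w₂, v₂} B] [Strict B]
  {C : Type u₃} [Bicategory.{w₃, v₃} C] [Strict C]

/-- `F ⊣ G` is simple with respect to `H ⊣ J` if the composite 2-adjunction is lax idempotent. -/
def IsSimpleWrt (adj : TwoAdjunction A B) (adj' : TwoAdjunction B C) : Prop :=
  (adj.comp adj').IsLaxIdempotent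

/-- `F ⊣ G` is 2-admissible with respect to `H ⊣ J` if the composite 2-adjunction is lax
idempotent and 2-premonadic. -/
def IsTwoAdmissibleWrt (adj : TwoAdjunction A B) (adj' : TwoAdjunction B C) : Prop :=
  (adj.comp adj').IsPreKockZoberlein

variable (adj : TwoAdjunction A B)

/-- `F ⊣ G` is simple: it is lax idempotent and, for each `y`, its lifting `A // F y ⟶ B // G F y` is
simple with respect to the 2-adjunction `η_y! ⊣ η_y^⇐ : B // G F y ⟶ B / y`. -/
def IsSimple (K : ∀ y : B, CommaObjectsAlong (adj.unit y)) : Prop :=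
  adj.IsLaxIdempotent ∧
    ∀ y : B, (LaxOver.liftAdjunction adj (adj.F.obj y)).IsSimpleWrt (StrictOver.changeOfBase (K y))

/-- `F ⊣ G` is 2-admissible: `G` is pre-Kock–Zöberlein and, for each `y`, the lifting
`A // F y ⟶ B // G F y` is 2-admissible with respect to the 2-adjunction
`η_y! ⊣ η_y^⇐ : B // G F y ⟶ B / y`. -/
def IsTwoAdmissible (K : ∀ y : B, CommaObjectsAlong (adj.unit y)) : Prop :=
  adj.IsPreKockZoberlein ∧
    ∀ y : B, (LaxOver.liftAdjunction adj (adj.F.obj y)).IsTwoAdmissibleWrt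
      (StrictOver.changeOfBase (K y))

variable {y : B} (K : CommaObjectsAlong (adj.unit y)) (a : LaxOver (adj.F.obj y))

/-- The comma object of `G a : G w ⟶ G F y` and `η_y : y ⟶ G F y`, for an object `a : w ⟶ F y` of
`A // F y`. -/
def commaUnit : CommaObject (adj.G.map a.arr) (adj.unit y) :=
  K ⟨adj.G.obj a.obj, adj.G.map a.arr⟩

/-- The object of `A // F y` obtained from `a` by applying `G`, taking the comma object along `η_y`,
and applying `F`. Its structure 1-cell is `ε_{F y} · F(η_y · η_y^⇐(G a))`, which is equal to
`F(η_y^⇐(G a))`, by one of the triangle identities. -/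
def comparisonSource : LaxOver (adj.F.obj y) where
  obj := adj.F.obj (adj.commaUnit K a).pt
  arr := adj.F.map ((adj.commaUnit K a).snd ≫ adj.unit y) ≫ adj.counit (adj.F.obj y)

theorem comparisonMor_eq :
    (adj.F.map (adj.commaUnit K a).fst ≫ adj.counit a.obj) ≫ a.arr =
      adj.F.map ((adj.commaUnit K a).fst ≫ adj.G.map a.arr) ≫ adj.counit (adj.F.obj y) := by
  rw [adj.F.map_comp, Category.assoc, Category.assoc, adj.counit_naturality]

/-- The morphism `(ε_w · F(δ_{G a}), id_{ε_{F y}} * F(λ))` of `A // F y` with codomain `a : w ⟶ F y`,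
where `λ` is the universal 2-cell of the comma object of `G a` and `η_y`, and `δ_{G a}` its
projection to `G w`. -/
def comparisonMor : adj.comparisonSource K a ⟶ a where
  mor := adj.F.map (adj.commaUnit K a).fst ≫ adj.counit a.obj
  cell := eqToHom (adj.comparisonMor_eq K a) ≫
    adj.F.map₂ (adj.commaUnit K a).cell ▷ adj.counit (adj.F.obj y)

/-- The domain of the comparison morphism is the value at `a` of the composite of the left and right
adjoints of the 2-adjunction `A // F y ⟶ B / y`. -/
theorem comparisonSource_eq : adj.comparisonSource K a =
    ((LaxOver.liftAdjunction adj (adj.F.obj y)).comp (StrictOver.changeOfBase K)).F.obj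
      (((LaxOver.liftAdjunction adj (adj.F.obj y)).comp (StrictOver.changeOfBase K)).G.obj a) :=
  rfl

theorem comparisonSource_arr :
    (adj.comparisonSource K a).arr = adj.F.map (adj.commaUnit K a).snd := by
  have h : adj.F.map ((adj.commaUnit K a).snd ≫ adj.unit y) ≫ adj.counit (adj.F.obj y) =
      adj.F.map (adj.commaUnit K a).snd := by
    rw [adj.F.map_comp, Category.assoc, adj.triangle_F, Category.comp_id]
  exact h

end TwoAdjunction

end TwoDim

/-! The statement reduces to a criterion for one 2-adjunction with counit ε: the right 2-adjoint is
2-premonadic exactly when every ε_a is a regular epimorphism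
(`isPremonadic_iff_isRegularEpi_counit`). It is applied, for each y, to the composite 2-adjunction A
// F y ⟶ B / y, whose counit at a is the morphism of the statement (`counit_comp_changeOfBase`). The
lax idempotency conditions occur on both sides of the equivalence and simply match.

For one direction of the criterion, premonadicity makes ε_a the coequalizer of FGε_a and ε_{FGa}
(`IsPremonadic.isCoequalizer_counit`). A 1-cell h : FGa ⟶ w that equalizes this pair transposes to a
1-cell Ga ⟶ Gw which is a morphism of algebras. Fullness of the comparison lifts it to k : a ⟶ w,
and transposing back gives ε_a ≫ k = h. Faithfulness gives uniqueness, because Gk is the transpose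
of ε_a ≫ k.

Conversely, let ε_a be the coequalizer of some pair p, q : z ⟶ FGa, and let m : Ga ⟶ Gb be an
algebra morphism. Its transpose Fm ≫ ε_b should factor through ε_a, so it has to equalize p and q.
By naturality of ε and the algebra equation, ε_z ≫ r ≫ Fm ≫ ε_b depends on r only through r ≫ ε_a,
which is the same for p and q; then ε_z, itself a regular epimorphism, is cancelled. The
factorization k satisfies Gk = m (`isPremonadic_of_isRegularEpi_counit`).

Each argument is made twice, for 1-cells and for 2-cells; in the second case ≗ absorbs the
identities between boundaries. -/

namespace TwoDim

/-! ### Cancellation along regular epimorphisms -/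

section Coequalizers

variable {C : Type u₁} [Bicategory.{w₁, v₁} C] [Strict C]

theorem IsRegularEpi.cancel {x y w : C} {f : x ⟶ y} (hf : IsRegularEpi f) {k k' : y ⟶ w}
    (h : f ≫ k = f ≫ k') : k = k' := by
  obtain ⟨z, p, q, h₀, h₁, -⟩ := hf
  exact (h₁ (f ≫ k') (by rw [← Category.assoc, h₀, Category.assoc])).unique h rfl

/-- The boundaries of the 2-cells agree by the 1-dimensional cancellation. Then f ◁ φ has the same
whiskering with both members of the pair, since these agree after composition with f, so its
factorization through f is unique. -/
theorem IsRegularEpi.cancel₂ {x y w : C} {f : x ⟶ y} (hf : IsRegularEpi f) {k k' l l' : y ⟶ w}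
    {θ : k ⟶ k'} {φ : l ⟶ l'} (h : f ◁ θ ≗ f ◁ φ) : θ ≗ φ := by
  obtain rfl := hf.cancel h.src
  obtain rfl := hf.cancel h.tgt
  obtain ⟨z, p, q, h₀, -, h₂⟩ := hf
  refine CellEq.of_eq ((h₂ k k' (f ◁ φ) ?_).unique h.eq rfl)
  refine (CellEq.comp_whiskerLeft _ _ _).symm.trans (CellEq.trans ?_ (CellEq.comp_whiskerLeft _ _ _))
  exact CellEq.whiskerLeft h₀ CellEq.rfl

end Coequalizers

/-! ### Transposition across a 2-adjunction -/

namespace TwoAdjunction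

variable {A : Type u₁} [Bicategory.{w₁, v₁} A] [Strict A]
  {B : Type u₂} [Bicategory.{w₂, v₂} B] [Strict B] (adj : TwoAdjunction A B)

/-- This lets Gf be recovered from ε_a ≫ f, as its transpose. It links precomposition with the
counit to the action of G, in both directions of the criterion. -/
theorem unit_map_counit_comp {a b : A} (f : a ⟶ b) :
    adj.unit (adj.G.obj a) ≫ adj.G.map (adj.counit a ≫ f) = adj.G.map f := by
  rw [adj.G.map_comp, ← Category.assoc, adj.triangle_G, Category.id_comp]

theorem unit_map_counit_whiskerLeft {a b : A} {f g : a ⟶ b} (θ : f ⟶ g) :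
    adj.unit (adj.G.obj a) ◁ adj.G.map₂ (adj.counit a ◁ θ) ≗ adj.G.map₂ θ := by
  refine (CellEq.whiskerLeft rfl (map₂_whiskerLeft adj.G _ _)).trans ?_
  refine (CellEq.comp_whiskerLeft _ _ _).symm.trans ?_
  exact (CellEq.whiskerLeft (adj.triangle_G a) CellEq.rfl).trans (CellEq.id_whiskerLeft _)

/-- This lemma, `map_transpose_counit` and their 2-cell versions say that transposition B(b, Ga) ≅
A(Fb, a) is inverse in both directions, on 1-cells and on 2-cells. -/
theorem unit_map_transpose {b : B} {a : A} (h : b ⟶ adj.G.obj a) :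
    adj.unit b ≫ adj.G.map (adj.F.map h ≫ adj.counit a) = h := by
  rw [adj.G.map_comp, ← Category.assoc, ← adj.unit_naturality, Category.assoc, adj.triangle_G,
    Category.comp_id]

theorem unit_map_transpose₂ {b : B} {a : A} {h h' : b ⟶ adj.G.obj a} (θ : h ⟶ h') :
    adj.unit b ◁ adj.G.map₂ (adj.F.map₂ θ ▷ adj.counit a) ≗ θ := by
  refine (CellEq.whiskerLeft rfl (map₂_whiskerRight adj.G _ _)).trans ?_
  refine (CellEq.whisker_assoc _ _ _).symm.trans ?_
  refine ((adj.unit_naturality₂ θ).symm.whiskerRight rfl).trans ?_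
  refine (CellEq.whiskerRight_comp _ _ _).symm.trans ?_
  exact (CellEq.whiskerRight CellEq.rfl (adj.triangle_G a)).trans (CellEq.whiskerRight_id _)

theorem map_transpose_counit {b : B} {a : A} (h : adj.F.obj b ⟶ a) :
    adj.F.map (adj.unit b ≫ adj.G.map h) ≫ adj.counit a = h := by
  rw [adj.F.map_comp, Category.assoc, adj.counit_naturality, ← Category.assoc, adj.triangle_F,
    Category.id_comp]

theorem map_transpose_counit₂ {b : B} {a : A} {h h' : adj.F.obj b ⟶ a} (θ : h ⟶ h') :
    adj.F.map₂ (adj.unit b ◁ adj.G.map₂ θ) ▷ adj.counit a ≗ θ := by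
  refine ((map₂_whiskerLeft adj.F _ _).whiskerRight rfl).trans ?_
  refine (CellEq.whisker_assoc _ _ _).trans ?_
  refine (CellEq.whiskerLeft rfl (adj.counit_naturality₂ θ)).trans ?_
  refine (CellEq.comp_whiskerLeft _ _ _).symm.trans ?_
  exact (CellEq.whiskerLeft (adj.triangle_F b) CellEq.rfl).trans (CellEq.id_whiskerLeft _)

/-! ### From premonadicity to coequalizers -/

theorem map_counit_unit (a : A) : adj.G.map (adj.counit a) ≫ adj.unit (adj.G.obj a) =
    adj.unit (adj.G.obj (adj.F.obj (adj.G.obj a))) ≫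
      adj.G.map (adj.F.map (adj.G.map (adj.counit a))) :=
  adj.unit_naturality _

/-- The transpose of a 1-cell that coequalizes `FGε` and `εFG` is a morphism of algebras. -/
theorem transpose_isAlgHom {a w : A} (h : adj.F.obj (adj.G.obj a) ⟶ w)
    (hh : adj.F.map (adj.G.map (adj.counit a)) ≫ h = adj.counit _ ≫ h) :
    adj.G.map (adj.F.map (adj.unit (adj.G.obj a) ≫ adj.G.map h)) ≫ adj.G.map (adj.counit w) =
      adj.G.map (adj.counit a) ≫ adj.unit (adj.G.obj a) ≫ adj.G.map h := by
  -- Both sides equal Gh: the left one by transposing back. On the right, naturality of the unit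
  -- turns Gε_a ≫ η into η ≫ GFGε_a, then `hh` replaces FGε_a by ε, and a triangle identity removes
  -- it.
  rw [← adj.G.map_comp, map_transpose_counit, ← Category.assoc, map_counit_unit, Category.assoc,
    ← adj.G.map_comp, hh, unit_map_counit_comp]

/-- The computation of `transpose_isAlgHom` with 2-cells: both sides reduce to Gξ. This is the
condition for the transpose of ξ to be a 2-cell of algebras. -/
theorem transpose_isAlgHom₂ {a w : A} {h h' : adj.F.obj (adj.G.obj a) ⟶ w} (ξ : h ⟶ h')
    (hξ : adj.F.map (adj.G.map (adj.counit a)) ◁ ξ ≗ adj.counit _ ◁ ξ) :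
    adj.G.map₂ (adj.F.map₂ (adj.unit (adj.G.obj a) ◁ adj.G.map₂ ξ)) ▷ adj.G.map (adj.counit w) ≗
      adj.G.map (adj.counit a) ◁ adj.unit (adj.G.obj a) ◁ adj.G.map₂ ξ := by
  refine (map₂_whiskerRight adj.G _ _).symm.trans ?_
  refine ((adj.map_transpose_counit₂ ξ).map adj.G).trans ?_
  refine CellEq.trans ?_ (CellEq.comp_whiskerLeft _ _ _)
  refine CellEq.trans ?_ (CellEq.whiskerLeft (adj.map_counit_unit a).symm CellEq.rfl)
  refine CellEq.trans ?_ (CellEq.comp_whiskerLeft _ _ _).symm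
  refine CellEq.trans ?_ (CellEq.whiskerLeft rfl (map₂_whiskerLeft adj.G _ _))
  refine CellEq.trans ?_ (CellEq.whiskerLeft rfl (hξ.map adj.G)).symm
  exact (adj.unit_map_counit_whiskerLeft ξ).symm

/-- If `G` is 2-premonadic, then `ε_a` is the coequalizer of `FGε_a` and `ε_{FGa}`. -/
theorem IsPremonadic.isCoequalizer_counit {adj : TwoAdjunction A B} (hG : adj.IsPremonadic)
    (a : A) : IsCoequalizer (adj.F.map (adj.G.map (adj.counit a)))
      (adj.counit (adj.F.obj (adj.G.obj a))) (adj.counit a) := by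
  refine ⟨adj.counit_naturality _, fun {w} h hh => ?_, fun {w} k k' ξ hξ => ?_⟩
  -- Fullness on 1-cells, applied to the transpose of h.
  · obtain ⟨k, hk⟩ := (hG a w).1.2 ⟨_, adj.transpose_isAlgHom h hh⟩
    have hk : adj.G.map k = adj.unit (adj.G.obj a) ≫ adj.G.map h :=
      congrArg TwoMonad.Alg.Hom.mor hk
    refine ⟨k, ?_, fun k' hk' => (hG a w).1.1 (TwoMonad.Alg.Hom.ext ?_)⟩
    · change adj.counit a ≫ k = h
      rw [← adj.counit_naturality, hk, map_transpose_counit]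
    · change adj.G.map k' = adj.G.map k
      -- Both Gk' and Gk are the transpose of h = ε_a ≫ k', so k' = k by faithfulness.
      rw [hk, ← hk', unit_map_counit_comp]
  · have e := adj.unit_map_counit_comp k
    have e' := adj.unit_map_counit_comp k'
    -- The transpose of ξ runs between the transposes of ε_a ≫ k and ε_a ≫ k', which equal Gk and
    -- Gk' only propositionally. The `eqToHom`s give it the boundary that fullness on 2-cells
    -- requires.
    let θ : adj.G.map k ⟶ adj.G.map k' :=
      eqToHom e.symm ≫ adj.unit (adj.G.obj a) ◁ adj.G.map₂ ξ ≫ eqToHom e'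
    have hθ : θ ≗ adj.unit (adj.G.obj a) ◁ adj.G.map₂ ξ :=
      (CellEq.eqToHom_comp _ _).trans (CellEq.comp_eqToHom _ _)
    have wθ : adj.G.map₂ (adj.F.map₂ θ) ▷ adj.G.map (adj.counit w) ≗
        adj.G.map (adj.counit a) ◁ θ :=
      (((hθ.map adj.F).map adj.G).whiskerRight rfl).trans
        ((adj.transpose_isAlgHom₂ ξ hξ).trans (CellEq.whiskerLeft rfl hθ.symm))
    obtain ⟨ζ, hζ⟩ := ((hG a w).2 k k').2 ⟨θ, wθ⟩
    have hζ : adj.G.map₂ ζ = θ := congrArg TwoMonad.Alg.Hom₂.cell hζ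
    refine ⟨ζ, CellEq.eq ?_, fun ζ' hζ' => ((hG a w).2 k k').1 (TwoMonad.Alg.Hom₂.ext ?_)⟩
    -- By naturality ε_a ◁ ζ is the transpose of Gζ = θ, and θ is itself the transpose of ξ.
    · refine (adj.counit_naturality₂ ζ).symm.trans ?_
      refine ((((CellEq.of_eq hζ).trans hθ).map adj.F).whiskerRight rfl).trans ?_
      exact adj.map_transpose_counit₂ ξ
    · change adj.G.map₂ ζ' = adj.G.map₂ ζ
      have hζ' : adj.counit a ◁ ζ' = ξ := hζ'
      -- The chain inside identifies θ, the transpose of ξ = ε_a ◁ ζ', with Gζ'.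
      rw [hζ, ← (hθ.trans (CellEq.trans (by rw [← hζ']; exact CellEq.rfl)
        (adj.unit_map_counit_whiskerLeft ζ'))).eq]

/-! ### From regular epimorphisms to premonadicity -/

/-- If the components of the counit are regular epimorphisms, then `G` is 2-premonadic. -/
theorem isPremonadic_of_isRegularEpi_counit {adj : TwoAdjunction A B}
    (hε : ∀ a, IsRegularEpi (adj.counit a)) : adj.IsPremonadic := by
  intro a b
  refine ⟨⟨fun f g hfg => ?_, fun h => ?_⟩, fun f g => ⟨fun θ φ hθφ => ?_, fun θ => ?_⟩⟩
  · have hfg : adj.G.map f = adj.G.map g := congrArg TwoMonad.Alg.Hom.mor hfg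
    refine (hε a).cancel ?_
    rw [← adj.counit_naturality, ← adj.counit_naturality, hfg]
  -- The pair p, q is arbitrary, not the canonical pair FGε_a, ε_{FGa}. This is why the counit at z
  -- enters the argument too.
  · obtain ⟨z, p, q, h₀, h₁, -⟩ := hε a
    obtain ⟨m, hm⟩ := h
    change adj.G.obj a ⟶ adj.G.obj b at m
    have hm : adj.G.map (adj.F.map m) ≫ adj.G.map (adj.counit b) =
      adj.G.map (adj.counit a) ≫ m := hm
    -- The right side involves r only through r ≫ ε_a. Naturality of the counit puts GFm ≫ Gε_b
    -- under F, where the algebra equation `hm` turns it into Gε_a ≫ m.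
    have key : ∀ r : z ⟶ adj.F.obj (adj.G.obj a), adj.counit z ≫ r ≫ adj.F.map m ≫ adj.counit b =
        adj.F.map (adj.G.map (r ≫ adj.counit a) ≫ m) ≫ adj.counit b := by
      intro r
      rw [← adj.counit_naturality, adj.G.map_comp, adj.G.map_comp, hm, adj.G.map_comp,
        Category.assoc]
    -- The transpose of m equalizes p and q after precomposition with ε_z, hence already before it.
    obtain ⟨k, hk, -⟩ := h₁ (adj.F.map m ≫ adj.counit b)
      ((hε z).cancel (by rw [key, key, h₀]))
    refine ⟨k, TwoMonad.Alg.Hom.ext ?_⟩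
    change adj.G.map k = m
    have hk : adj.counit a ≫ k = adj.F.map m ≫ adj.counit b := hk
    -- Gk and m have the same transpose, namely ε_a ≫ k.
    rw [← adj.unit_map_counit_comp, hk, unit_map_transpose]
  · have hθφ : adj.G.map₂ θ = adj.G.map₂ φ := congrArg TwoMonad.Alg.Hom₂.cell hθφ
    refine ((hε a).cancel₂ ?_).eq
    refine (adj.counit_naturality₂ θ).symm.trans ?_
    rw [hθφ]
    exact adj.counit_naturality₂ φ
  · obtain ⟨z, p, q, h₀, -, h₂⟩ := hε a
    obtain ⟨t, ht⟩ := θ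
    change adj.G.map f ⟶ adj.G.map g at t
    have ht : adj.G.map₂ (adj.F.map₂ t) ▷ adj.G.map (adj.counit b) ≗
      adj.G.map (adj.counit a) ◁ t := ht
    -- The same mechanism on 2-cells: the right side sees r only through r ≫ ε_a.
    have key : ∀ r : z ⟶ adj.F.obj (adj.G.obj a),
        adj.counit z ◁ r ◁ adj.F.map₂ t ▷ adj.counit b ≗
        adj.F.map₂ (adj.G.map (r ≫ adj.counit a) ◁ t) ▷ adj.counit b := by
      intro r
      refine (adj.counit_naturality₂ _).symm.trans ?_
      refine CellEq.whiskerRight (CellEq.map adj.F ?_) rfl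
      refine (map₂_whiskerLeft adj.G _ _).trans ?_
      refine (CellEq.whiskerLeft rfl ((map₂_whiskerRight adj.G _ _).trans ht)).trans ?_
      refine (CellEq.comp_whiskerLeft _ _ _).symm.trans ?_
      exact CellEq.whiskerLeft (adj.G.map_comp _ _).symm CellEq.rfl
    -- The transpose of t, with its boundary rewritten by naturality so that the 2-dimensional
    -- universal property of ε_a applies.
    let ξ : adj.counit a ≫ f ⟶ adj.counit a ≫ g :=
      eqToHom (adj.counit_naturality f).symm ≫ adj.F.map₂ t ▷ adj.counit b ≫
        eqToHom (adj.counit_naturality g)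
    have hξ : ξ ≗ adj.F.map₂ t ▷ adj.counit b :=
      (CellEq.eqToHom_comp _ _).trans (CellEq.comp_eqToHom _ _)
    have hpq : p ◁ adj.F.map₂ t ▷ adj.counit b ≗ q ◁ adj.F.map₂ t ▷ adj.counit b := by
      refine (hε z).cancel₂ ((key p).trans (CellEq.trans ?_ (key q).symm))
      rw [h₀]
      exact CellEq.rfl
    obtain ⟨ζ, hζ, -⟩ := h₂ f g ξ ((CellEq.whiskerLeft rfl hξ).trans
      (hpq.trans (CellEq.whiskerLeft rfl hξ.symm)))
    refine ⟨ζ, TwoMonad.Alg.Hom₂.ext (CellEq.eq ?_)⟩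
    change adj.G.map₂ ζ ≗ t
    refine (adj.unit_map_counit_whiskerLeft ζ).symm.trans ?_
    exact (CellEq.whiskerLeft rfl (((CellEq.of_eq hζ).trans hξ).map adj.G)).trans
      (adj.unit_map_transpose₂ t)

/-- The right 2-adjoint is 2-premonadic if and only if the counit is componentwise a regular
epimorphism. -/
theorem isPremonadic_iff_isRegularEpi_counit (adj : TwoAdjunction A B) :
    adj.IsPremonadic ↔ ∀ a, IsRegularEpi (adj.counit a) :=
  ⟨fun h a => ⟨_, _, _, h.isCoequalizer_counit a⟩, isPremonadic_of_isRegularEpi_counit⟩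

/-! ### The counit of the composite 2-adjunction -/

/-- The comparison morphism at `a` is the component at `a` of the counit of the composite
2-adjunction `A // F y ⟶ B / y`. -/
theorem counit_comp_changeOfBase {y : B} (K : CommaObjectsAlong (adj.unit y))
    (a : LaxOver (adj.F.obj y)) :
    ((LaxOver.liftAdjunction adj (adj.F.obj y)).comp (StrictOver.changeOfBase K)).counit a =
      adj.comparisonMor K a := by
  refine LaxOver.Hom.ext' rfl ?_
  -- The lifted counit carries an identity 2-cell, so only the 2-cell of the other factor survives:
  -- the image of the universal 2-cell λ under F, whiskered with ε_{F y}.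
  refine (LaxOver.comp_cell_right _ _ (LaxOver.liftCounit_isId adj a)).trans ?_
  refine (LaxOver.directImageMap_cell _ _).trans ?_
  refine ((LaxOver.liftMap_cell adj.F _).whiskerRight rfl).trans ?_
  exact (CellEq.eqToHom_comp (adj.comparisonMor_eq K a) _).symm

end TwoAdjunction

end TwoDim

/-! ### 2-admissibility and simplicity -/

theorem mainTheorem6
    {A : Type u₁} [Bicategory.{w₁, v₁} A] [Bicategory.Strict A]
    {B : Type u₂} [Bicategory.{w₂, v₂} B] [Bicategory.Strict B]
    (adj : TwoDim.TwoAdjunction A B)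
    (K : ∀ y : B, TwoDim.CommaObjectsAlong (adj.unit y))
    (hG : adj.IsPreKockZoberlein) :
    adj.IsTwoAdmissible K ↔
      adj.IsSimple K ∧
        ∀ (y : B) (a : TwoDim.LaxOver (adj.F.obj y)),
          TwoDim.IsRegularEpi (adj.comparisonMor (K y) a) := by
  have key : ∀ y : B, ((TwoDim.LaxOver.liftAdjunction adj (adj.F.obj y)).comp
      (TwoDim.StrictOver.changeOfBase (K y))).IsPremonadic ↔
        ∀ a : TwoDim.LaxOver (adj.F.obj y), TwoDim.IsRegularEpi (adj.comparisonMor (K y) a) := by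
    intro y
    rw [TwoDim.TwoAdjunction.isPremonadic_iff_isRegularEpi_counit]
    refine forall_congr' fun a => ?_
    rw [TwoDim.TwoAdjunction.counit_comp_changeOfBase]
    -- The domains of the two morphisms agree by definition, as in `comparisonSource_eq`.
    rfl
  constructor
  -- Pre-Kock–Zöberlein splits into lax idempotency, which is simplicity, and premonadicity, which
  -- is translated by `key`.
  · rintro ⟨-, h⟩
    exact ⟨⟨hG.1, fun y => (h y).1⟩, fun y => (key y).1 (h y).2⟩
  · rintro ⟨⟨-, h⟩, hε⟩
    exact ⟨hG, fun y => ⟨h y, (key y).2 (hε y)⟩⟩
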